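/- Let $n\in\{2,3\}$, let $B_2=\{\tfrac12+m : m\in\mathbb Z\}$ and $B_3=\mathbb Z\setminus\{0\}$, and let $\nu\in\left(-\frac{n-1}{2},\frac{n-1}{2}\right)$. For $k\in B_n$ put $\gamma=\sqrt{k^2-\nu^2}$ and let $\xi\in\mathbb R$ satisfy $e^{-2i\xi}=\frac{\gamma-i\nu}{k}$. For $x>0$ set $$F_k^{\nu}(x)=\frac{\sqrt2\,|\Gamma(\gamma+1+i\nu)|}{\Gamma(2\gamma+1)}e^{\pi\nu/2}(2x)^{\gamma-\frac{n-1}{2}}\,\mathrm{Re}\left\{e^{i(x+\xi)}{}_1F_1(\gamma-i\nu,2\gamma+1,-2ix)\right\},$$ $$G_k^{\nu}(x)=\frac{i\sqrt2\,|\Gamma(\gamma+1+i\nu)|}{\Gamma(2\gamma+1)}e^{\pi\nu/2}(2x)^{\gamma-\frac{n-1}{2}}\,\mathrm{Im}\left\{e^{i(x+\xi)}{}_1F_1(\gamma-i\nu,2\gamma+1,-2ix)\right\},$$ where ${}_1F_1(a,b,z)=\sum_{m\ge0}\frac{(a)_m}{(b)_m}\frac{z^m}{m!}$. With $x=\varepsilon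 r$ these are the radial components of the generalized eigenstates, of energy $\varepsilon>0$, of the massless Dirac-Coulomb operator with charge $\nu$ in dimension $n$; those of energy $-\varepsilon$ are obtained by replacing $(\nu,k)$ with $(-\nu,-k)$. Let $$H_k(x)=\begin{pmatrix}F_k^{\nu}(x)&G_k^{\nu}(x)\\ F_{-k}^{-\nu}(x)&G_{-k}^{-\nu}(x)\end{pmatrix},\qquad S_k^{\sigma}(r,s)=\int_0^{\infty}H_k(\varepsilon r)\,H_k^{*}(\varepsilon s)\,\varepsilon^{n-1+\sigma}\,d\varepsilon ,$$ where $H_k^*$ denotes either the conjugate transpose of $H_k$ or its transpose without conjugation; the statement holds for each of the two choices. Let $\alpha>\frac12$. For every $k\in B_n$ with $\alpha<\sqrt{k^2-\nu^2}+\frac12$ there is a real constant $C_k$ (depending on $n,\nu,\alpha,k$ and on the choice of $H_k^*$) such that, for all $\tau>0$, the integral defining $S_k^{-2\alpha}(\tau,\tau)$ converges absolutely and $$\mathrm{Tr}\,S_k^{-2\alpha}(\tau,\tau)=C_k\,\tau^{2\alpha-n}.$$ Moreover, for fixed $n,\nu,\alpha$, one has $\sup_k|C_k|<\infty$, the supremum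 being over all $k\in B_n$ with $\sqrt{k^2-\nu^2}+\frac12>\alpha$. -/

import Mathlib

noncomputable section

namespace DiracCoulomb

/-- Admissible angular indices: half-integers in dimension `2`, nonzero integers in
dimension `3` (only these two dimensions are used). -/
def indexSet (n : ℕ) : Set ℝ :=
  if n = 2 then {k | ∃ m : ℤ, k = 1 / 2 + (m : ℝ)}
  else {k | ∃ m : ℤ, m ≠ 0 ∧ k = (m : ℝ)}

/-- The confluent hypergeometric function
`₁F₁(a, b, z) = ∑ (a)_m / (b)_m * z ^ m / m!` with the rising Pochhammer symbols `(·)_m`. -/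
def oneFOne (a b z : ℂ) : ℂ :=
  ∑' m : ℕ, (ascPochhammer ℂ m).eval a / (ascPochhammer ℂ m).eval b *
    (z ^ m / (m.factorial : ℂ))

/-- `γ = √(k² - ν²)`. -/
def gam (ν k : ℝ) : ℝ := √(k ^ 2 - ν ^ 2)

/-- A real phase shift `ξ` with `e^{-2iξ} = (γ - iν) / k`. The right-hand side has modulus one,
so that `ξ` is determined up to a multiple of `π`. -/
def phase (ν k : ℝ) : ℝ :=
  -(((gam ν k : ℂ) - Complex.I * (ν : ℂ)) / (k : ℂ)).arg / 2

/-- The common real prefactor of the two radial components, as a function of `x = ε r`. -/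
def amplitude (n : ℕ) (ν k x : ℝ) : ℝ :=
  √2 * ‖Complex.Gamma ((gam ν k : ℂ) + 1 + Complex.I * (ν : ℂ))‖ /
      Real.Gamma (2 * gam ν k + 1) *
    Real.exp (Real.pi * ν / 2) * (2 * x) ^ (gam ν k - ((n : ℝ) - 1) / 2)

/-- `e^{i(x + ξ)} ₁F₁(γ - iν, 2γ + 1, -2ix)`, with `x = ε r`. -/
def wave (ν k x : ℝ) : ℂ :=
  Complex.exp (Complex.I * ((x : ℂ) + (phase ν k : ℂ))) *
    oneFOne ((gam ν k : ℂ) - Complex.I * (ν : ℂ)) (2 * (gam ν k : ℂ) + 1)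
      (-2 * Complex.I * (x : ℂ))

/-- The upper radial component `F_{k,ε}(r)` of the generalized eigenstate of energy `ε > 0`;
it depends on `ε` and `r` through `x = ε r` only. -/
def radF (n : ℕ) (ν k x : ℝ) : ℂ :=
  ((amplitude n ν k x * (wave ν k x).re : ℝ) : ℂ)

/-- The lower radial component `G_{k,ε}(r)` (purely imaginary), with `x = ε r`. -/
def radG (n : ℕ) (ν k x : ℝ) : ℂ :=
  Complex.I * ((amplitude n ν k x * (wave ν k x).im : ℝ) : ℂ)

/-- The matrix `H_k` at `x = ε r`: the first row holds the components of the eigenstate of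
energy `ε`, the second row those for energy `-ε`, which are obtained from the formulas for
positive energy by reversing the signs of both `ν` and `k`. -/
def matH (n : ℕ) (ν k x : ℝ) : Matrix (Fin 2) (Fin 2) ℂ :=
  !![radF n ν k x, radG n ν k x; radF n (-ν) (-k) x, radG n (-ν) (-k) x]

/-- The integrand `H_k(ε r) H_k^*(ε s) ε^{n-1+σ}`, where the operation `H ↦ H^*` is `adj`. -/
def kernelIntegrand (adj : Matrix (Fin 2) (Fin 2) ℂ → Matrix (Fin 2) (Fin 2) ℂ)
    (n : ℕ) (ν k σ r s ε : ℝ) : Matrix (Fin 2) (Fin 2) ℂ :=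
  ((ε ^ ((n : ℝ) - 1 + σ) : ℝ) : ℂ) • (matH n ν k (ε * r) * adj (matH n ν k (ε * s)))

/-- The kernel `S_k^σ(r, s) = ∫_0^∞ H_k(ε r) H_k^*(ε s) ε^{n-1+σ} dε`, integrated entry by
entry. -/
def kernelS (adj : Matrix (Fin 2) (Fin 2) ℂ → Matrix (Fin 2) (Fin 2) ℂ)
    (n : ℕ) (ν k σ r s : ℝ) : Matrix (Fin 2) (Fin 2) ℂ :=
  Matrix.of fun i j => ∫ ε in Set.Ioi (0 : ℝ), kernelIntegrand adj n ν k σ r s ε i j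

end DiracCoulomb

end

/-! Substituting `x = ε τ` turns the trace into `τ ^ (2α - n)` times a constant, namely `2 ^
(-(n-1))` times the sum, over the two signs of energy, of the moments `∫ q(x) x ^ (-2α) dx`. Here
`q` is a quadratic form in one radial wave `ψ = u + iv` (without its volume factor), and `|q|` is at
most the density `u² + v²`. Near `0` the density is `O(x ^ (2γ))`, which is integrable against the
weight because `α < γ + 1/2`; at infinity it is bounded, and `α > 1/2` suffices.

The work is in the uniformity in `k`, for which the integral is never computed. Kummer's
transformation shows that `ψ` solves the first-order radial Dirac system
(`isRadialSolution_radialWave`). The quantities `u² + v²`, `u² - v²` and `2uv` then satisfy a closed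
linear system, which yields for each `b ≥ 0` an explicit function `virial`, asymptotic to `x ^ (-b)`
times the density, whose derivative is the density times an explicit weight (`hasDerivAt_virial`).
When `k² - ν²` is large, a fixed combination of three such weights dominates a positive multiple of
`x ^ (-2α)`. Integrating over the half-line bounds the moment by a constant, independent of `k`,
times the limit of the density at infinity (`exists_integral_density_le`).

That limit is `2` for every `k` (`tendsto_density_radialWave`), which is the purpose of the Gamma
factors in the normalization. The limit exists by the differential system alone. Its value comes
from an explicit Laplace-type transform of the confluent function, evaluated for large parameter
(`gammaTransform_kummer`, `norm_limit_kummer`). Only finitely many `k` escape the condition that `k²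
- ν²` be large, so the supremum is finite. -/

namespace DiracCoulomb

open Complex Filter Topology ComplexConjugate MeasureTheory

/-! ### The confluent hypergeometric series and its derivative. -/

/-- The coefficient of `z ^ m / m!` in the confluent hypergeometric series. -/
noncomputable def pochRatio (a b : ℂ) (m : ℕ) : ℂ :=
  (ascPochhammer ℂ m).eval a / (ascPochhammer ℂ m).eval b

theorem ascPochhammer_eval_succ_left (a : ℂ) (m : ℕ) :
    (ascPochhammer ℂ (m + 1)).eval a = a * (ascPochhammer ℂ m).eval (a + 1) := by
  rw [ascPochhammer_succ_left]; simp

theorem add_natCast_ne_zero_of_one_le_re {b : ℂ} (hb : 1 ≤ b.re) (m : ℕ) : b + m ≠ 0 := by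
  intro h
  have := congrArg Complex.re h
  simp at this
  have : (0 : ℝ) ≤ m := m.cast_nonneg
  linarith

theorem ascPochhammer_eval_ne_zero {b : ℂ} (hb : 1 ≤ b.re) (m : ℕ) :
    (ascPochhammer ℂ m).eval b ≠ 0 := by
  induction m with
  | zero => simp
  | succ m ih =>
    rw [ascPochhammer_succ_eval]
    exact mul_ne_zero ih (add_natCast_ne_zero_of_one_le_re hb m)

theorem pochRatio_succ (a b : ℂ) (m : ℕ) :
    pochRatio a b (m + 1) = pochRatio a b m * ((a + m) / (b + m)) := by
  simp only [pochRatio, ascPochhammer_succ_eval]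
  rw [mul_div_mul_comm]

theorem norm_pochRatio_le (a : ℂ) {b : ℂ} (hb : 1 ≤ b.re) (m : ℕ) :
    ‖pochRatio a b m‖ ≤ (‖a‖ + 1) ^ m := by
  induction m with
  | zero => simp [pochRatio]
  | succ m ih =>
    rw [pochRatio_succ, norm_mul, pow_succ]
    refine mul_le_mul ih ?_ (norm_nonneg _) (by positivity)
    have h1 : ((m : ℝ) + 1) ≤ ‖b + m‖ := by
      refine le_trans ?_ (Complex.re_le_norm _)
      simp; linarith
    rw [norm_div, div_le_iff₀ (lt_of_lt_of_le (by positivity) h1)]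
    have h2 : ‖a + m‖ ≤ ‖a‖ + m := (norm_add_le _ _).trans (by simp)
    have := norm_nonneg a
    have : (0 : ℝ) ≤ m := m.cast_nonneg
    nlinarith

theorem summable_norm_oneFOne (a : ℂ) {b : ℂ} (hb : 1 ≤ b.re) (z : ℂ) :
    Summable fun m : ℕ => ‖pochRatio a b m * (z ^ m / (m.factorial : ℂ))‖ := by
  refine Summable.of_nonneg_of_le (fun _ => norm_nonneg _) (fun m => ?_)
    (Real.summable_pow_div_factorial ((‖a‖ + 1) * ‖z‖))
  rw [norm_mul, norm_div, norm_pow, mul_pow, mul_div_assoc]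
  simp only [norm_natCast]
  exact mul_le_mul_of_nonneg_right (norm_pochRatio_le a hb m) (by positivity)

theorem hasSum_oneFOne (a : ℂ) {b : ℂ} (hb : 1 ≤ b.re) (z : ℂ) :
    HasSum (fun m : ℕ => pochRatio a b m * (z ^ m / (m.factorial : ℂ))) (oneFOne a b z) :=
  (summable_norm_oneFOne a hb z).of_norm.hasSum

theorem oneFOne_zero (a b : ℂ) : oneFOne a b 0 = 1 := by
  unfold oneFOne
  rw [tsum_eq_single 0]
  · simp
  · intro m hm; simp [hm]

theorem conj_oneFOne (a b z : ℂ) : conj (oneFOne a b z) = oneFOne (conj a) (conj b) (conj z) := by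
  have h : ∀ (m : ℕ) (w : ℂ), conj ((ascPochhammer ℂ m).eval w)
      = (ascPochhammer ℂ m).eval (conj w) := by
    intro m w
    induction m with
    | zero => simp
    | succ m ih => simp [ascPochhammer_succ_eval, ih]
  unfold oneFOne
  rw [Complex.conj_tsum]
  refine tsum_congr fun m => ?_
  simp [h]

theorem hasDerivAt_oneFOne_tsum (a : ℂ) {b : ℂ} (hb : 1 ≤ b.re) (z : ℂ) :
    HasDerivAt (oneFOne a b)
      (∑' m : ℕ, pochRatio a b m * ((m : ℂ) * z ^ (m - 1) / (m.factorial : ℂ))) z := by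
  set R := ‖z‖ + 1 with hR
  have hs : Summable fun m : ℕ => (‖a‖ + 1) ^ m * ((m : ℝ) * R ^ (m - 1) / (m.factorial : ℝ)) := by
    rw [← summable_nat_add_iff 1]
    refine ((Real.summable_pow_div_factorial ((‖a‖ + 1) * R)).mul_left (‖a‖ + 1)).congr ?_
    intro m
    have : (m.factorial : ℝ) ≠ 0 := by positivity
    rw [Nat.factorial_succ]
    push_cast
    have : (m : ℝ) + 1 ≠ 0 := by positivity
    rw [mul_pow, pow_succ]
    field_simp
  change HasDerivAt (fun w => ∑' m : ℕ, pochRatio a b m * (w ^ m / (m.factorial : ℂ))) _ z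
  refine hasDerivAt_tsum_of_isPreconnected (t := Metric.ball (0 : ℂ) R) hs Metric.isOpen_ball
    (convex_ball _ _).isPreconnected (g := fun m w => pochRatio a b m * (w ^ m / (m.factorial : ℂ)))
    (g' := fun m w => pochRatio a b m * ((m : ℂ) * w ^ (m - 1) / (m.factorial : ℂ)))
    ?_ ?_ (y₀ := 0) ?_ (summable_norm_oneFOne a hb 0).of_norm ?_
  · intro m w _
    exact ((hasDerivAt_pow m w).div_const _).const_mul _
  · intro m w hw
    have hw' : ‖w‖ ≤ R := by simpa using (mem_ball_zero_iff.1 hw).le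
    rw [norm_mul, norm_div, norm_mul, norm_pow]
    simp only [Complex.norm_natCast]
    gcongr
    exact norm_pochRatio_le a hb m
  · simp [hR]; positivity
  · simp [hR]

/-- The contiguous relation expressing the derivative through a shift of the first parameter. -/
theorem hasDerivAt_oneFOne (a : ℂ) {b : ℂ} (hb : 1 ≤ b.re) {z : ℂ} (hz : z ≠ 0) :
    HasDerivAt (oneFOne a b) (a * (oneFOne (a + 1) b z - oneFOne a b z) / z) z := by
  convert hasDerivAt_oneFOne_tsum a hb z using 1
  symm
  have h := (((hasSum_oneFOne (a + 1) hb z).sub (hasSum_oneFOne a hb z)).mul_left a).div_const z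
  refine HasSum.tsum_eq (h.congr_fun ?_)
  intro m
  -- Since `a (a+1)_m = (a)_m (a+m)`, the difference in the first parameter reproduces the factor
  -- `m` of termwise differentiation.
  have hp : a * (pochRatio (a + 1) b m - pochRatio a b m) = pochRatio a b m * m := by
    have h1 : a * (ascPochhammer ℂ m).eval (a + 1) = (ascPochhammer ℂ m).eval a * (a + m) := by
      rw [← ascPochhammer_eval_succ_left, ascPochhammer_succ_eval]
    simp only [pochRatio]
    rw [← sub_div, mul_div_assoc', mul_sub, h1]
    ring
  cases m with
  | zero => simp [pochRatio]
  | succ m =>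
    have : ((m + 1).factorial : ℂ) ≠ 0 := by exact_mod_cast (m + 1).factorial_ne_zero
    simp only [Nat.add_sub_cancel]
    rw [← sub_mul, ← mul_assoc, hp]
    field_simp
    try ring

/-! ### Kummer's transformation. -/

/-- A form of the Chu–Vandermonde identity. Shifting `a` and `b` together keeps `b - a` fixed; after
Pascal's rule the terms of index `j` combine through `(b + j) - (b - a + j) = a`, which is the
factor in `(a)_(m+1) = a (a+1)_m`. -/
theorem sum_choose_mul_ascPochhammer (m : ℕ) (a b : ℂ) :
    ∑ j ∈ Finset.range (m + 1), (m.choose j : ℂ) * (-1) ^ j * (ascPochhammer ℂ j).eval (b - a) *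
      (ascPochhammer ℂ (m - j)).eval (b + j) = (ascPochhammer ℂ m).eval a := by
  induction m generalizing a b with
  | zero => simp
  | succ m ih =>
    rw [ascPochhammer_eval_succ_left, ← ih (a + 1) (b + 1), Finset.sum_range_succ', Finset.mul_sum]
    have e1 : ∀ j ∈ Finset.range (m + 1),
        ((m + 1).choose (j + 1) : ℂ) * (-1) ^ (j + 1) * (ascPochhammer ℂ (j + 1)).eval (b - a) *
          (ascPochhammer ℂ (m + 1 - (j + 1))).eval (b + (j + 1 : ℕ)) =
        (m.choose j : ℂ) * (-1) ^ (j + 1) * (ascPochhammer ℂ (j + 1)).eval (b - a) *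
          (ascPochhammer ℂ (m - j)).eval (b + 1 + j) +
        (m.choose (j + 1) : ℂ) * (-1) ^ (j + 1) * (ascPochhammer ℂ (j + 1)).eval (b - a) *
          (ascPochhammer ℂ (m + 1 - (j + 1))).eval (b + (j + 1 : ℕ)) := by
      intro j _
      rw [Nat.choose_succ_succ, Nat.add_sub_add_right, Nat.succ_eq_add_one]
      push_cast
      ring_nf
    rw [Finset.sum_congr rfl e1, Finset.sum_add_distrib, add_assoc]
    have e2 := Finset.sum_range_succ' (fun j => (m.choose j : ℂ) * (-1) ^ j *
      (ascPochhammer ℂ j).eval (b - a) * (ascPochhammer ℂ (m + 1 - j)).eval (b + j)) (m + 1)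
    have e3 : ((m + 1).choose 0 : ℂ) = (m.choose 0 : ℂ) := by simp
    rw [e3, ← e2, Finset.sum_range_succ _ (m + 1)]
    rw [Nat.choose_eq_zero_of_lt (Nat.lt_succ_self m), Nat.cast_zero, zero_mul, zero_mul, zero_mul,
      add_zero]
    rw [← Finset.sum_add_distrib]
    refine Finset.sum_congr rfl fun j hj => ?_
    have hj' : j ≤ m := Nat.lt_succ_iff.1 (Finset.mem_range.1 hj)
    rw [Nat.succ_sub hj', ascPochhammer_eval_succ_left (b + j), ascPochhammer_succ_eval,
      show b + 1 - (a + 1) = b - a by ring, show b + (j : ℂ) + 1 = b + 1 + j by ring]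
    ring

theorem ascPochhammer_eval_add (b : ℂ) (j i : ℕ) :
    (ascPochhammer ℂ (j + i)).eval b
      = (ascPochhammer ℂ j).eval b * (ascPochhammer ℂ i).eval (b + j) := by
  induction i with
  | zero => simp
  | succ i ih =>
    rw [← add_assoc, ascPochhammer_succ_eval, ih, ascPochhammer_succ_eval]
    push_cast; ring

/-- Kummer's transformation. -/
theorem exp_mul_oneFOne (a : ℂ) {b : ℂ} (hb : 1 ≤ b.re) (z : ℂ) :
    exp z * oneFOne (b - a) b (-z) = oneFOne a b z := by
  have hexp : exp z = ∑' m : ℕ, z ^ m / (m.factorial : ℂ) := by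
    rw [Complex.exp_eq_exp_ℂ, NormedSpace.exp_eq_tsum_div]
  have hexps : Summable fun m : ℕ => ‖z ^ m / (m.factorial : ℂ)‖ := by
    simpa using Real.summable_pow_div_factorial ‖z‖
  have hF := summable_norm_oneFOne (b - a) hb (-z)
  rw [mul_comm, hexp]
  change (∑' m : ℕ, pochRatio (b - a) b m * ((-z) ^ m / (m.factorial : ℂ))) * _ = _
  -- Cauchy product; the coefficients are compared by Chu–Vandermonde, using `(b)_(j+i) = (b)_j
  -- (b+j)_i`.
  rw [tsum_mul_tsum_eq_tsum_sum_range_of_summable_norm hF hexps]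
  refine tsum_congr fun m => ?_
  rw [← sum_choose_mul_ascPochhammer m a b, Finset.sum_div, Finset.sum_mul]
  refine Finset.sum_congr rfl fun j hj => ?_
  obtain ⟨i, rfl⟩ := Nat.exists_eq_add_of_le (Nat.lt_succ_iff.1 (Finset.mem_range.1 hj))
  have h1 := ascPochhammer_eval_ne_zero hb (j + i)
  rw [ascPochhammer_eval_add] at h1 ⊢
  have h2 := left_ne_zero_of_mul h1
  have h3 := right_ne_zero_of_mul h1
  have h4 : ((j + i).choose j : ℂ) * (j.factorial : ℂ) * (i.factorial : ℂ)
      = ((j + i).factorial : ℂ) := by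
    have := Nat.choose_mul_factorial_mul_factorial (Nat.le_add_right j i)
    rw [Nat.add_sub_cancel_left] at this
    exact_mod_cast this
  have h5 : (j.factorial : ℂ) ≠ 0 := by exact_mod_cast j.factorial_ne_zero
  have h6 : (i.factorial : ℂ) ≠ 0 := by exact_mod_cast i.factorial_ne_zero
  have h7 : ((j + i).factorial : ℂ) ≠ 0 := by exact_mod_cast (j + i).factorial_ne_zero
  simp only [pochRatio, Nat.add_sub_cancel_left]
  rw [neg_pow]
  field_simp
  rw [← h4]
  ring

/-! ### A closed first-order system for the confluent factor. -/

/-- The confluent hypergeometric factor of the radial wave. -/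
noncomputable def kummer (γ ν x : ℝ) : ℂ :=
  oneFOne ((γ : ℂ) - I * ν) (2 * (γ : ℂ) + 1) (-2 * I * x)

/-- The difference of the two contiguous confluent functions. -/
noncomputable def kummerDiff (γ ν x : ℝ) : ℂ :=
  exp (-2 * I * x) * conj (kummer γ ν x) - kummer γ ν x

/-- For `a = γ - iν` and `b = 2γ + 1` one has `b - (a + 1) = conj a`, while `-z = conj z` for
imaginary `z`. Kummer's transformation thus expresses the shifted function through the conjugate of
the original, and the derivative formula closes up. -/
theorem oneFOne_contiguous {γ : ℝ} (hγ : 0 ≤ γ) (ν x : ℝ) :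
    oneFOne ((γ : ℂ) - I * ν + 1) (2 * (γ : ℂ) + 1) (-2 * I * x)
      = exp (-2 * I * x) * conj (kummer γ ν x) := by
  rw [← exp_mul_oneFOne _ (by simp; exact hγ), kummer, conj_oneFOne]
  simp only [map_sub, map_mul, map_add, map_neg, conj_I, conj_ofReal, map_one, map_ofNat]
  ring_nf

theorem continuous_kummer {γ : ℝ} (hγ : 0 ≤ γ) (ν : ℝ) : Continuous (kummer γ ν) := by
  have h : Continuous (oneFOne ((γ : ℂ) - I * ν) (2 * (γ : ℂ) + 1)) :=
    continuous_iff_continuousAt.2 fun z =>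
      (hasDerivAt_oneFOne_tsum _ (by simp; exact hγ) z).continuousAt
  unfold kummer
  exact h.comp (by fun_prop)

theorem kummer_zero (γ ν : ℝ) : kummer γ ν 0 = 1 := by
  simp [kummer, oneFOne_zero]

theorem hasDerivAt_kummer {γ : ℝ} (hγ : 0 ≤ γ) (ν : ℝ) {x : ℝ} (hx : x ≠ 0) :
    HasDerivAt (kummer γ ν) (((γ : ℂ) - I * ν) * kummerDiff γ ν x / x) x := by
  have hx' : (x : ℂ) ≠ 0 := by exact_mod_cast hx
  have h1 : HasDerivAt (fun y : ℝ => -2 * I * (y : ℂ)) (-2 * I * 1) x :=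
    (Complex.ofRealCLM.hasDerivAt (x := x)).const_mul (-2 * I)
  have h2 := hasDerivAt_oneFOne ((γ : ℂ) - I * ν) (b := 2 * (γ : ℂ) + 1) (by simp; exact hγ)
    (z := -2 * I * x) (by simp [hx])
  have h3 := h2.comp x h1
  rw [oneFOne_contiguous hγ] at h3
  refine h3.congr_deriv ?_
  rw [kummerDiff, ← kummer]
  field_simp

theorem hasDerivAt_kummerDiff {γ : ℝ} (hγ : 0 ≤ γ) (ν : ℝ) {x : ℝ} (hx : x ≠ 0) :
    HasDerivAt (kummerDiff γ ν)
      (-2 * I * (kummer γ ν x + kummerDiff γ ν x) - 2 * γ * kummerDiff γ ν x / x) x := by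
  have hx' : (x : ℂ) ≠ 0 := by exact_mod_cast hx
  have h1 : HasDerivAt (fun y : ℝ => -2 * I * (y : ℂ)) (-2 * I * 1) x :=
    (Complex.ofRealCLM.hasDerivAt (x := x)).const_mul (-2 * I)
  have hk := hasDerivAt_kummer hγ ν hx
  have h4 := (h1.cexp.mul hk.star).sub hk
  refine h4.congr_deriv ?_
  have e : exp (-2 * I * x) * conj (exp (-2 * I * x)) = 1 := by
    rw [← exp_conj, ← exp_add]
    simp only [map_mul, map_neg, conj_I, conj_ofReal, map_ofNat]
    ring_nf
    simp
  -- This antisymmetry lets the two terms carrying `conj a` and `a` add up to `-(a + conj a) = -2γ`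
  -- times `kummerDiff γ ν x / x`.
  have e2 : exp (-2 * I * x) * conj (kummerDiff γ ν x) = - kummerDiff γ ν x := by
    rw [kummerDiff]
    simp only [map_sub, map_mul, conj_conj]
    linear_combination (kummer γ ν x) * e
  have e3 : exp (-2 * I * x) * conj (kummer γ ν x) = kummer γ ν x + kummerDiff γ ν x := by
    rw [kummerDiff]; ring
  simp only [star_def, map_div₀, map_mul, map_sub, conj_ofReal, conj_I]
  have e4 : exp (-2 * I * ↑x) * ((↑γ - -I * ↑ν) * conj (kummerDiff γ ν x) / ↑x)
      = (↑γ - -I * ↑ν) / x * (-kummerDiff γ ν x) := by rw [← e2]; ring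
  have e5 : exp (-2 * I * ↑x) * (-2 * I * 1) * conj (kummer γ ν x) =
      -2 * I * (kummer γ ν x + kummerDiff γ ν x) := by rw [← e3]; ring
  rw [e4, e5]
  field_simp
  ring

/-! ### The radial Dirac system and its quadratic quantities. -/

/-- The radial massless Dirac-Coulomb system at unit energy, in complex form `ψ = u + i v`. -/
def IsRadialSolution (ν k : ℝ) (ψ : ℝ → ℂ) : Prop :=
  ∀ x : ℝ, 0 < x →
    HasDerivAt ψ (I * (1 + (ν : ℂ) / x) * ψ x + (k : ℂ) / x * conj (ψ x)) x

/-- The density `u² + v²`. -/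
def density (ψ : ℝ → ℂ) (x : ℝ) : ℝ := (ψ x).re ^ 2 + (ψ x).im ^ 2

/-- The difference `u² - v²`. -/
def imbalance (ψ : ℝ → ℂ) (x : ℝ) : ℝ := (ψ x).re ^ 2 - (ψ x).im ^ 2

/-- The cross term `2uv`. -/
def crossTerm (ψ : ℝ → ℂ) (x : ℝ) : ℝ := 2 * (ψ x).re * (ψ x).im

theorem density_eq_norm_sq (ψ : ℝ → ℂ) (x : ℝ) : density ψ x = ‖ψ x‖ ^ 2 := by
  rw [Complex.sq_norm, normSq_apply, density]; ring

theorem density_nonneg (ψ : ℝ → ℂ) (x : ℝ) : 0 ≤ density ψ x := by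
  unfold density; positivity

theorem abs_imbalance_le (ψ : ℝ → ℂ) (x : ℝ) : |imbalance ψ x| ≤ density ψ x := by
  unfold imbalance density
  rw [abs_le]; constructor <;> nlinarith [sq_nonneg (ψ x).re, sq_nonneg (ψ x).im]

theorem abs_crossTerm_le (ψ : ℝ → ℂ) (x : ℝ) : |crossTerm ψ x| ≤ density ψ x := by
  unfold crossTerm density
  rw [abs_le]
  constructor <;> nlinarith [sq_nonneg ((ψ x).re + (ψ x).im), sq_nonneg ((ψ x).re - (ψ x).im)]

namespace IsRadialSolution

variable {ν k : ℝ} {ψ : ℝ → ℂ}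

theorem hasDerivAt_re (h : IsRadialSolution ν k ψ) {x : ℝ} (hx : 0 < x) :
    HasDerivAt (fun y => (ψ y).re) (k / x * (ψ x).re - (1 + ν / x) * (ψ x).im) x := by
  have := reCLM.hasFDerivAt.comp_hasDerivAt x (h x hx)
  refine this.congr_deriv ?_
  rw [show (1 + (ν : ℂ) / x) = ((1 + ν / x : ℝ) : ℂ) by push_cast; rfl,
    show (k : ℂ) / x = ((k / x : ℝ) : ℂ) by push_cast; rfl]
  simp only [reCLM_apply, add_re, mul_re, mul_im, I_re, I_im, ofReal_re, ofReal_im, conj_re,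
    conj_im]
  ring

theorem hasDerivAt_im (h : IsRadialSolution ν k ψ) {x : ℝ} (hx : 0 < x) :
    HasDerivAt (fun y => (ψ y).im) (-(k / x) * (ψ x).im + (1 + ν / x) * (ψ x).re) x := by
  have := imCLM.hasFDerivAt.comp_hasDerivAt x (h x hx)
  refine this.congr_deriv ?_
  rw [show (1 + (ν : ℂ) / x) = ((1 + ν / x : ℝ) : ℂ) by push_cast; rfl,
    show (k : ℂ) / x = ((k / x : ℝ) : ℂ) by push_cast; rfl]
  simp only [imCLM_apply, add_im, mul_re, mul_im, I_re, I_im, ofReal_re, ofReal_im, conj_re,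
    conj_im]
  ring

theorem hasDerivAt_density (h : IsRadialSolution ν k ψ) {x : ℝ} (hx : 0 < x) :
    HasDerivAt (density ψ) (2 * k / x * imbalance ψ x) x := by
  refine (((h.hasDerivAt_re hx).pow 2).add ((h.hasDerivAt_im hx).pow 2)).congr_deriv ?_
  simp only [imbalance]; push_cast; ring

theorem hasDerivAt_imbalance (h : IsRadialSolution ν k ψ) {x : ℝ} (hx : 0 < x) :
    HasDerivAt (imbalance ψ) (2 * k / x * density ψ x - 2 * (1 + ν / x) * crossTerm ψ x) x := by
  refine (((h.hasDerivAt_re hx).pow 2).sub ((h.hasDerivAt_im hx).pow 2)).congr_deriv ?_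
  simp only [density, crossTerm]; push_cast; ring

theorem hasDerivAt_crossTerm (h : IsRadialSolution ν k ψ) {x : ℝ} (hx : 0 < x) :
    HasDerivAt (crossTerm ψ) (2 * (1 + ν / x) * imbalance ψ x) x := by
  refine (((h.hasDerivAt_re hx).const_mul 2).mul (h.hasDerivAt_im hx)).congr_deriv ?_
  simp only [imbalance]; ring

theorem continuousOn (h : IsRadialSolution ν k ψ) : ContinuousOn ψ (Set.Ioi 0) :=
  fun x hx => (h x hx).continuousAt.continuousWithinAt

theorem continuousOn_density (h : IsRadialSolution ν k ψ) :
    ContinuousOn (density ψ) (Set.Ioi 0) :=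
  fun _ hx => (h.hasDerivAt_density hx).continuousAt.continuousWithinAt

/-! ### Behaviour of solutions at infinity. -/

/-- The density has a limit at infinity. -/
theorem exists_tendsto_density (h : IsRadialSolution ν k ψ) :
    ∃ m, Tendsto (density ψ) atTop (𝓝 m) := by
  set c := |k| + |ν| with hc
  have hc0 : 0 ≤ c := by positivity
  set R : ℝ → ℝ := fun x => k * crossTerm ψ x - ν * density ψ x with hR
  have hRle : ∀ x, |R x| ≤ c * density ψ x := by
    intro x
    calc |R x| ≤ |k * crossTerm ψ x| + |ν * density ψ x| := abs_sub _ _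
      _ = |k| * |crossTerm ψ x| + |ν| * density ψ x := by
        rw [abs_mul, abs_mul, abs_of_nonneg (density_nonneg ψ x)]
      _ ≤ |k| * density ψ x + |ν| * density ψ x := by
        gcongr; exact abs_crossTerm_le ψ x
      _ = c * density ψ x := by rw [hc]; ring
  -- The derivative of `R` is `2k` times the imbalance, so subtracting `R / x` cancels the `1/x`
  -- term of the derivative of the density and leaves the integrable rate `R / x²`.
  set E : ℝ → ℝ := fun x => density ψ x - R x / x with hE
  have hE' : ∀ x, 0 < x → HasDerivAt E (R x / x ^ 2) x := by
    intro x hx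
    have h1 := (((h.hasDerivAt_crossTerm hx).const_mul k).sub
      ((h.hasDerivAt_density hx).const_mul ν)).div (hasDerivAt_id x) hx.ne'
    refine ((h.hasDerivAt_density hx).sub h1).congr_deriv ?_
    simp only [hR, Pi.sub_apply, id]
    field_simp
    ring
  set x₀ := 2 * c + 1 with hx₀
  have hx₀pos : 0 < x₀ := by positivity
  have hEM : ∀ x, x₀ ≤ x → |R x / x| ≤ density ψ x / 2 := by
    intro x hx
    have hxpos : 0 < x := hx₀pos.trans_le hx
    rw [abs_div, abs_of_pos hxpos, div_le_iff₀ hxpos]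
    have := hRle x
    have := density_nonneg ψ x
    nlinarith
  -- Gronwall factor: for large `x` one has `R ≤ c · density ≤ 2c E`, so `E' ≤ 2c E / x²` and `g`
  -- decreases; being nonnegative, it converges.
  set g : ℝ → ℝ := fun x => E x * Real.exp (2 * c / x) with hg
  have hg' : ∀ x, 0 < x → HasDerivAt g
      (Real.exp (2 * c / x) / x ^ 2 * (R x - 2 * c * E x)) x := by
    intro x hx
    have h1 : HasDerivAt (fun y : ℝ => 2 * c / y) (-(2 * c) / x ^ 2) x := by
      refine ((hasDerivAt_inv hx.ne').const_mul (2 * c)).congr_deriv ?_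
      field_simp
    refine ((hE' x hx).mul h1.exp).congr_deriv ?_
    field_simp
    ring
  have hanti : AntitoneOn g (Set.Ici x₀) := by
    refine antitoneOn_of_deriv_nonpos (convex_Ici _) ?_ ?_ ?_
    · intro x hx
      exact (hg' x (hx₀pos.trans_le hx)).continuousAt.continuousWithinAt
    · intro x hx
      rw [interior_Ici] at hx
      exact (hg' x (hx₀pos.trans hx)).differentiableAt.differentiableWithinAt
    · intro x hx
      rw [interior_Ici] at hx
      rw [(hg' x (hx₀pos.trans hx)).deriv]
      refine mul_nonpos_of_nonneg_of_nonpos (by positivity) ?_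
      have h1 := (abs_le.1 (hEM x (le_of_lt hx))).2
      have h2 := (abs_le.1 (hRle x)).2
      simp only [hE]
      nlinarith
  have hEpos : ∀ x, x₀ ≤ x → density ψ x / 2 ≤ E x := by
    intro x hx
    have h1 := (abs_le.1 (hEM x hx)).2
    simp only [hE]; linarith
  have hgl : ∃ l, Tendsto g atTop (𝓝 l) := by
    have hanti' : Antitone fun x => g (max x x₀) := fun x y hxy =>
      hanti (Set.mem_Ici.2 (le_max_right _ _)) (Set.mem_Ici.2 (le_max_right _ _))
        (max_le_max_right _ hxy)
    have hbdd : BddBelow (Set.range fun x => g (max x x₀)) := by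
      refine ⟨0, ?_⟩
      rintro _ ⟨x, rfl⟩
      have := hEpos _ (le_max_right x x₀)
      have := density_nonneg ψ (max x x₀)
      simp only [hg]
      exact mul_nonneg (by linarith) (Real.exp_pos _).le
    refine ⟨_, (tendsto_atTop_ciInf hanti' hbdd).congr' ?_⟩
    filter_upwards [eventually_ge_atTop x₀] with x hx
    rw [max_eq_left hx]
  obtain ⟨l, hl⟩ := hgl
  have hexp : Tendsto (fun x : ℝ => Real.exp (-(2 * c / x))) atTop (𝓝 1) := by
    have : Tendsto (fun x : ℝ => -(2 * c / x)) atTop (𝓝 (-0)) :=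
      (tendsto_const_nhds.div_atTop tendsto_id).neg
    rw [neg_zero] at this
    rw [← Real.exp_zero]
    exact (Real.continuous_exp.tendsto _).comp this
  have hEl : Tendsto E atTop (𝓝 (l * 1)) := by
    refine (hl.mul hexp).congr fun x => ?_
    simp only [hg, mul_assoc, ← Real.exp_add, add_neg_cancel, Real.exp_zero, mul_one]
  have hRx : Tendsto (fun x => R x / x) atTop (𝓝 0) := by
    have hub : Tendsto (fun x : ℝ => c * (2 * E x) / x) atTop (𝓝 0) :=
      ((hEl.const_mul 2).const_mul c).div_atTop tendsto_id
    refine squeeze_zero_norm' ?_ hub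
    filter_upwards [eventually_ge_atTop x₀] with x hx
    have hxpos : 0 < x := hx₀pos.trans_le hx
    rw [Real.norm_eq_abs, abs_div, abs_of_pos hxpos]
    gcongr
    refine (hRle x).trans ?_
    gcongr
    linarith [hEpos x hx]
  refine ⟨l * 1 + 0, (hEl.add hRx).congr fun x => ?_⟩
  simp [hE]

theorem exists_bound (h : IsRadialSolution ν k ψ) :
    ∃ C X : ℝ, 0 < X ∧ 0 ≤ C ∧ ∀ x, X ≤ x → density ψ x ≤ C := by
  obtain ⟨m, hm⟩ := h.exists_tendsto_density
  have hev := hm.eventually_le_const (lt_add_one m)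
  obtain ⟨X, hX⟩ := eventually_atTop.1 hev
  refine ⟨|m + 1|, max X 1, by positivity, abs_nonneg _, fun x hx => ?_⟩
  exact (hX x (le_trans (le_max_left _ _) hx)).trans (le_abs_self _)

/-- After removal of the Coulomb phase, a solution converges at infinity. -/
theorem exists_tendsto_unwound (h : IsRadialSolution ν k ψ) :
    ∃ L : ℂ, Tendsto (fun x : ℝ => exp (-I * (x + ν * Real.log x)) * ψ x) atTop (𝓝 L) := by
  obtain ⟨C, X, hX, hC, hb⟩ := h.exists_bound
  set e : ℝ → ℂ := fun x => exp (-I * (x + ν * Real.log x)) with he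
  have hnorm : ∀ x, ‖e x‖ = 1 := by
    intro x
    have : -I * ((x : ℂ) + ν * Real.log x) = ((-(x + ν * Real.log x) : ℝ) : ℂ) * I := by
      push_cast; ring
    simp only [he, this, norm_exp_ofReal_mul_I]
  have he' : ∀ x, 0 < x → HasDerivAt e (-I * (1 + (ν : ℂ) / x) * e x) x := by
    intro x hx
    have h1 : HasDerivAt (fun y : ℝ => ((y + ν * Real.log y : ℝ) : ℂ))
        ((1 + ν * x⁻¹ : ℝ) : ℂ) x :=
      ((hasDerivAt_id x).add ((Real.hasDerivAt_log hx.ne').const_mul ν)).ofReal_comp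
    have h2 := (h1.const_mul (-I)).cexp
    simp only [he]
    have h3 : (fun y : ℝ => exp (-I * (y + ν * Real.log y)))
        = fun y : ℝ => exp (-I * ((y + ν * Real.log y : ℝ) : ℂ)) := by
      ext y; push_cast; rfl
    rw [h3]
    refine h2.congr_deriv ?_
    push_cast
    rw [div_eq_mul_inv]; ring
  -- The derivative of `e ψ` is `(k/x) e conj ψ`, oscillating but only `O(1/x)`. Subtracting `S`
  -- amounts to one integration by parts and leaves an absolutely integrable `O(1/x²)` remainder.
  set S : ℝ → ℂ := fun x => k * I / 2 * (x : ℂ)⁻¹ * (e x * conj (ψ x)) with hS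
  set T' : ℝ → ℂ := fun x =>
    -(e x * ((k * ν - k * I / 2) * conj (ψ x) + k ^ 2 * I / 2 * ψ x)) * ((x ^ 2 : ℝ) : ℂ)⁻¹ with hT'
  have hT : ∀ x, 0 < x → HasDerivAt (fun y => e y * ψ y - S y) (T' x) x := by
    intro x hx
    have hx' : (x : ℂ) ≠ 0 := by exact_mod_cast hx.ne'
    have h1 : HasDerivAt (fun y : ℝ => (y : ℂ)⁻¹) (-((x : ℂ) ^ 2)⁻¹) x := by
      have := (hasDerivAt_inv hx.ne').ofReal_comp
      simpa using this
    have h2 := ((he' x hx).mul (h x hx)).sub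
      ((h1.const_mul (k * I / 2)).mul ((he' x hx).mul (h x hx).star))
    refine h2.congr_deriv ?_
    simp only [hT', star_def, map_add, map_mul, map_div₀, conj_I, conj_ofReal, map_one, conj_conj,
      Pi.mul_apply]
    push_cast
    field_simp
    linear_combination (2 * e x * k * (x + ν) * conj (ψ x)) * I_sq
  have hcont : ContinuousOn T' (Set.Ioi X) := by
    have hψ : ContinuousOn ψ (Set.Ioi X) := h.continuousOn.mono (Set.Ioi_subset_Ioi hX.le)
    have hec : ContinuousOn e (Set.Ioi X) := fun x hx =>
      (he' x (hX.trans hx)).continuousAt.continuousWithinAt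
    have hψs : ContinuousOn (fun x => conj (ψ x)) (Set.Ioi X) :=
      continuous_conj.comp_continuousOn hψ
    refine ContinuousOn.mul (by fun_prop) (ContinuousOn.inv₀ (by fun_prop) ?_)
    intro x hx
    have : x ≠ 0 := (hX.trans hx).ne'
    exact_mod_cast pow_ne_zero 2 this
  have hint : MeasureTheory.IntegrableOn T' (Set.Ioi X) := by
    have hi : MeasureTheory.IntegrableOn
        (fun x : ℝ => (‖(k * ν - k * I / 2 : ℂ)‖ + ‖(k ^ 2 * I / 2 : ℂ)‖) * √C * x ^ (-2 : ℝ))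
        (Set.Ioi X) :=
      (integrableOn_Ioi_rpow_of_lt (by norm_num) hX).const_mul _
    refine MeasureTheory.Integrable.mono' hi (hcont.aestronglyMeasurable measurableSet_Ioi) ?_
    refine (MeasureTheory.ae_restrict_iff' measurableSet_Ioi).2 (Eventually.of_forall fun x hx => ?_)
    have hxp : 0 < x := hX.trans hx
    have hψb : ‖ψ x‖ ≤ √C := by
      refine Real.le_sqrt_of_sq_le ?_
      rw [← density_eq_norm_sq]; exact hb x (le_of_lt hx)
    simp only [hT']
    rw [norm_mul, norm_neg, norm_mul, hnorm, one_mul, norm_inv, norm_real,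
      Real.norm_of_nonneg (by positivity), Real.rpow_neg hxp.le]
    norm_cast
    gcongr
    refine (norm_add_le _ _).trans ?_
    rw [norm_mul, norm_mul, RCLike.norm_conj, add_mul]
    push_cast
    gcongr
  have hlim := MeasureTheory.tendsto_limUnder_of_hasDerivAt_of_integrableOn_Ioi
    (fun x hx => hT x (hX.trans hx)) hint
  have hS0 : Tendsto S atTop (𝓝 0) := by
    have hub : Tendsto (fun x : ℝ => ‖(k * I / 2 : ℂ)‖ * √C / x) atTop (𝓝 0) :=
      tendsto_const_nhds.div_atTop tendsto_id
    refine squeeze_zero_norm' ?_ hub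
    filter_upwards [eventually_ge_atTop X] with x hx
    have hxp : 0 < x := hX.trans_le hx
    have hψb : ‖ψ x‖ ≤ √C := by
      refine Real.le_sqrt_of_sq_le ?_
      rw [← density_eq_norm_sq]; exact hb x hx
    simp only [hS]
    rw [norm_mul, norm_mul, norm_mul, hnorm, one_mul, RCLike.norm_conj, norm_inv, norm_real,
      Real.norm_of_nonneg hxp.le, mul_assoc, mul_comm x⁻¹, ← mul_assoc, ← div_eq_mul_inv]
    gcongr
  exact ⟨_, (hlim.add hS0).congr fun x => sub_add_cancel _ _⟩

/-! ### Virial identities. -/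

/-- A primitive of the density with a power weight. -/
noncomputable def virial (ν k b : ℝ) (ψ : ℝ → ℂ) (x : ℝ) : ℝ :=
  x ^ (-b) * (density ψ x - (k * crossTerm ψ x - ν * density ψ x) / x +
    k * (1 + b) * imbalance ψ x / (2 * x ^ 2) + (1 + b) * (2 + b) * density ψ x / (4 * x ^ 2) -
    k * ν * (1 + b) / (2 + b) * crossTerm ψ x / x ^ 2 +
    ν * (1 + b) / (2 + b) * (x + ν) * density ψ x / x ^ 2)

/-- The weight appearing in the derivative of `virial`. -/
noncomputable def virialWeight (ν k b x : ℝ) : ℝ :=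
  x ^ (-b) * (-b / x + ν * (1 + b) * (1 / (2 + b) - 2) / x ^ 2 +
    (1 + b) * (k ^ 2 - ν ^ 2 - (1 + b / 2) ^ 2) / x ^ 3)

/-- The corrections in `virial` are chosen so that the contributions of `imbalance` and `crossTerm`
to the derivative cancel at every order in `1/x`, leaving only the density, whose sign is known. -/
theorem hasDerivAt_virial (h : IsRadialSolution ν k ψ) {b : ℝ} (hb : 0 ≤ b) {x : ℝ} (hx : 0 < x) :
    HasDerivAt (virial ν k b ψ) (density ψ x * virialWeight ν k b x) x := by
  have hy : HasDerivAt (fun t : ℝ => t ^ (-b)) (-b * x ^ (-b) / x) x := by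
    refine (Real.hasDerivAt_rpow_const (Or.inl hx.ne')).congr_deriv ?_
    rw [Real.rpow_sub_one hx.ne', mul_div_assoc]
  have hM := h.hasDerivAt_density hx
  have hD := h.hasDerivAt_imbalance hx
  have hP := h.hasDerivAt_crossTerm hx
  have hid := hasDerivAt_id x
  have hb2 : 2 + b ≠ 0 := by positivity
  have hx0 := hx.ne'
  have key := hy.mul ((((((hM.sub (((hP.const_mul k).sub (hM.const_mul ν)).div hid hx0)).add
    ((hD.const_mul (k * (1 + b))).div ((hid.pow 2).const_mul 2) (by simp [hx0]))).add
    ((hM.const_mul ((1 + b) * (2 + b))).div ((hid.pow 2).const_mul 4) (by simp [hx0]))).sub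
    ((hP.const_mul (k * ν * (1 + b) / (2 + b))).div (hid.pow 2) (by simp [hx0])))).add
    ((((hid.add_const ν).const_mul (ν * (1 + b) / (2 + b))).mul hM).div (hid.pow 2)
      (by simp [hx0])))
  refine key.congr_deriv ?_
  simp only [virialWeight, Pi.add_apply, Pi.sub_apply, Pi.mul_apply, Pi.div_apply, Pi.pow_apply, id]
  generalize x ^ (-b) = y
  generalize density ψ x = M
  generalize imbalance ψ x = D
  generalize crossTerm ψ x = P
  field_simp
  push_cast
  ring

end IsRadialSolution
-- Positive weights and the Morawetz bound.
section Morawetz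

open IsRadialSolution

/-- Powers used to dominate `x ^ (-s)` from above and to interpolate between decay rates. -/
theorem exists_rpow_interpolation {s : ℝ} (hs : 1 < s) :
    ∃ β N X : ℝ, 0 < β ∧ 2 ≤ N ∧ 1 ≤ X ∧ ∀ x : ℝ, 0 < x →
      x ^ (-β) ≤ 1 + x ^ (-N) ∧ x ^ (-N) / x ≤ (1 + x ^ (-N)) / x ^ 3 ∧
      (1 + x ^ (-N)) / x ^ 2 ≤ β / (2 * (1 + β)) / 8 * (x ^ (-β) / x) +
        X * ((1 + x ^ (-N)) / x ^ 3) ∧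
      x ^ (-s) ≤ x ^ (-β) / x + x ^ (-N) / x ^ 3 := by
  -- `1 + β ≤ s` handles `x ^ (-s)` for `x ≥ 1`; `β ≤ 1/2` gives `x ^ (β-1) ≤ X ^ (-1/2)` for `x ≥
  -- X` below.
  obtain ⟨β, hβ0, hβ1, hβs⟩ : ∃ β : ℝ, 0 < β ∧ β ≤ 1 / 2 ∧ 1 + β ≤ s :=
    ⟨min (s - 1) (1 / 2), lt_min (by linarith) (by norm_num), min_le_right _ _, by
      linarith [min_le_left (s - 1) (1 / 2)]⟩
  -- `N ≥ 2` makes `x ^ (-N) / x` at most `1 / x³` for `x ≥ 1`; `N ≥ s` handles `x ^ (-s)` near `0`.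
  obtain ⟨N, hN2, hNs⟩ : ∃ N : ℝ, 2 ≤ N ∧ s ≤ N := ⟨max 2 s, le_max_left _ _, le_max_right _ _⟩
  set d : ℝ := β / (2 * (1 + β)) with hd
  have hd0 : 0 < d := by positivity
  have hd1 : d ≤ 1 := by
    rw [hd, div_le_one (by positivity)]; linarith
  -- Chosen so that `X ^ (-1/2) = d / 16`. Beyond `X` the inverse-square terms are absorbed by the
  -- term `u / x`, below it by the inverse-cube term.
  set X : ℝ := (16 / d) ^ 2 with hX
  have hX1 : 1 ≤ X := by
    have : 1 ≤ 16 / d := by rw [le_div_iff₀ hd0]; linarith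
    nlinarith
  refine ⟨β, N, X, hβ0, hN2, hX1, fun x hx => ?_⟩
  set u := x ^ (-β) with hu
  set v := x ^ (-N) with hv
  have hu0 : 0 < u := Real.rpow_pos_of_pos hx _
  have hv0 : 0 < v := Real.rpow_pos_of_pos hx _
  have huv : u ≤ 1 + v := by
    rcases le_total 1 x with h | h
    · have : u ≤ 1 := Real.rpow_le_one_of_one_le_of_nonpos h (by linarith)
      linarith
    · have : u ≤ v := Real.rpow_le_rpow_of_exponent_ge hx h (by linarith)
      linarith
  have hvx : v / x ≤ (1 + v) / x ^ 3 := by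
    rw [div_le_div_iff₀ hx (by positivity)]
    rcases le_total 1 x with h | h
    · have h1 : v ≤ x ^ (-(2 : ℝ)) := Real.rpow_le_rpow_of_exponent_le h (by linarith)
      have h2 : x ^ (-(2 : ℝ)) = (x ^ 2)⁻¹ := by
        rw [Real.rpow_neg hx.le]; norm_cast
      rw [h2, ← one_div, le_div_iff₀ (by positivity)] at h1
      nlinarith
    · have : x ^ 2 ≤ 1 := by nlinarith
      nlinarith [mul_pos hv0 hx]
  have hmid : (1 + v) / x ^ 2 ≤ d / 8 * (u / x) + X * ((1 + v) / x ^ 3) := by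
    rcases le_total X x with h | h
    · have h1x : 1 ≤ x := hX1.trans h
      have hv1 : v ≤ 1 := Real.rpow_le_one_of_one_le_of_nonpos h1x (by linarith)
      have hux : x⁻¹ ≤ d / 16 * u := by
        have e1 : x⁻¹ = u * x ^ (β - 1) := by
          rw [hu, ← Real.rpow_add hx, ← Real.rpow_neg_one]; congr 1; ring
        have e2 : x ^ (β - 1) ≤ X ^ (-(1 / 2) : ℝ) :=
          (Real.rpow_le_rpow_of_exponent_le h1x (by linarith)).trans
            (Real.rpow_le_rpow_of_nonpos (by positivity) h (by norm_num))
        have e3 : X ^ (-(1 / 2) : ℝ) = d / 16 := by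
          rw [Real.rpow_neg (by positivity), ← Real.sqrt_eq_rpow, hX,
            Real.sqrt_sq (by positivity), inv_div]
        rw [e1, mul_comm]
        rw [e3] at e2
        gcongr
      have h2 : (1 + v) / x ^ 2 ≤ d / 8 * (u / x) := by
        calc (1 + v) / x ^ 2 ≤ 2 / x ^ 2 := by gcongr; linarith
          _ = 2 * x⁻¹ / x := by field_simp
          _ ≤ 2 * (d / 16 * u) / x := by gcongr
          _ = d / 8 * (u / x) := by ring
      have : 0 ≤ X * ((1 + v) / x ^ 3) := by positivity
      linarith
    · have h2 : (1 + v) / x ^ 2 ≤ X * ((1 + v) / x ^ 3) := by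
        calc (1 + v) / x ^ 2 = x * ((1 + v) / x ^ 3) := by field_simp
          _ ≤ _ := by gcongr
      have : 0 ≤ d / 8 * (u / x) := by positivity
      linarith
  have hlow : x ^ (-s) ≤ u / x + v / x ^ 3 := by
    have e1 : u / x = x ^ (-(1 + β)) := by
      rw [hu, div_eq_mul_inv, ← Real.rpow_neg_one, ← Real.rpow_add hx]; congr 1; ring
    have e2 : v / x ^ 3 = x ^ (-(3 + N)) := by
      rw [hv, div_eq_mul_inv, ← Real.rpow_natCast, ← Real.rpow_neg hx.le, ← Real.rpow_add hx]
      congr 1; push_cast; ring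
    rcases le_total 1 x with h | h
    · have : x ^ (-s) ≤ x ^ (-(1 + β)) := Real.rpow_le_rpow_of_exponent_le h (by linarith)
      have : 0 < v / x ^ 3 := by positivity
      linarith
    · have : x ^ (-s) ≤ x ^ (-(3 + N)) := Real.rpow_le_rpow_of_exponent_ge hx h (by linarith)
      have : 0 < u / x := by positivity
      linarith
  exact ⟨huv, hvx, hmid, hlow⟩

/-- A combination of virial weights that dominates a given power when `k² - ν²` is large. -/
theorem exists_le_virialWeight {s : ℝ} (hs : 1 < s) :
    ∃ β N η ζ δ g₀ : ℝ, 0 < β ∧ 2 ≤ N ∧ 0 < δ ∧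
      ∀ ν k : ℝ, |ν| ≤ 1 → g₀ ≤ k ^ 2 - ν ^ 2 → ∀ x : ℝ, 0 < x →
        δ * x ^ (-s) ≤ virialWeight ν k 0 x - η * virialWeight ν k β x +
          ζ * virialWeight ν k N x := by
  obtain ⟨β, N, X, hβ0, hN2, hX1, hpow⟩ := exists_rpow_interpolation hs
  set d : ℝ := β / (2 * (1 + β)) with hd
  have hd0 : 0 < d := by positivity
  have hd1 : d ≤ 1 := by
    rw [hd, div_le_one (by positivity)]; linarith
  -- Exponent `0` supplies a large positive `1/x³`; subtracting exponent `β` adds decay `x ^ (-1-β)`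
  -- at infinity and costs at most half of `g = k² - ν²`; adding exponent `N` gives the strong
  -- weight near `0`. The indefinite `1/x²` terms total at most `3 (1+v) / x²`. The threshold makes
  -- `g / 2` cover their cubic share `3X`, the loss `(1 + N/2)²`, the negative `v / x` term and the
  -- cubic part of the target.
  refine ⟨β, N, 1 / (2 * (1 + β)), 1 / (1 + N), d / 2, 2 * (4 * X + 2 + (1 + N / 2) ^ 2),
    hβ0, hN2, by positivity, fun ν k hν hg x hx => ?_⟩
  set g := k ^ 2 - ν ^ 2 with hgdef
  obtain ⟨huv, hvx, hmid, hlow⟩ := hpow x hx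
  have hu0 : 0 < x ^ (-β) := Real.rpow_pos_of_pos hx _
  have hv0 : 0 < x ^ (-N) := Real.rpow_pos_of_pos hx _
  have hcoef : ∀ b : ℝ, 0 ≤ b → |ν * (1 / (2 + b) - 2)| ≤ 2 := by
    intro b hb
    have h1 : 0 < 1 / (2 + b) := by positivity
    have h2 : 1 / (2 + b) ≤ 1 := by rw [div_le_one (by positivity)]; linarith
    rw [abs_mul]
    have : |1 / (2 + b) - 2| ≤ 2 := by rw [abs_le]; constructor <;> linarith
    nlinarith [abs_nonneg ν, abs_nonneg (1 / (2 + b) - 2)]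
  have c0 := abs_le.1 (hcoef 0 le_rfl)
  have cβ := abs_le.1 (hcoef β hβ0.le)
  have cN := abs_le.1 (hcoef N (by linarith))
  have e0 : virialWeight ν k 0 x = ν * (1 / (2 + 0) - 2) * (1 / x ^ 2) + (g - 1) * (1 / x ^ 3) := by
    simp only [virialWeight, neg_zero, Real.rpow_zero]; ring
  have eβ : 1 / (2 * (1 + β)) * virialWeight ν k β x = -(d * (x ^ (-β) / x)) +
      1 / 2 * (ν * (1 / (2 + β) - 2)) * (x ^ (-β) / x ^ 2) +
      1 / 2 * (g - (1 + β / 2) ^ 2) * (x ^ (-β) / x ^ 3) := by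
    simp only [virialWeight, ← hgdef, hd]; field_simp
  have eN : 1 / (1 + N) * virialWeight ν k N x = -(N / (1 + N) * (x ^ (-N) / x)) +
      (ν * (1 / (2 + N) - 2)) * (x ^ (-N) / x ^ 2) + (g - (1 + N / 2) ^ 2) * (x ^ (-N) / x ^ 3) := by
    have : 1 + N ≠ 0 := by positivity
    have : 2 + N ≠ 0 := by positivity
    simp only [virialWeight, ← hgdef]; field_simp
  rw [e0, eβ, eN]
  clear e0 eβ eN hpow
  clear_value g
  generalize x ^ (-β) = u at *
  generalize x ^ (-N) = v at *
  generalize x ^ (-s) = w at *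
  have hN1 : N / (1 + N) ≤ 1 := by rw [div_le_one (by linarith)]; linarith
  have p2 : 0 < 1 / x ^ 2 := by positivity
  have p3 : 0 < 1 / x ^ 3 := by positivity
  have t0 : -2 * (1 / x ^ 2) ≤ ν * (1 / (2 + 0) - 2) * (1 / x ^ 2) :=
    mul_le_mul_of_nonneg_right c0.1 p2.le
  have tβ : 1 / 2 * (ν * (1 / (2 + β) - 2)) * (u / x ^ 2) ≤ (1 + v) / x ^ 2 := by
    calc 1 / 2 * (ν * (1 / (2 + β) - 2)) * (u / x ^ 2) ≤ 1 * (u / x ^ 2) := by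
          gcongr; linarith [cβ.2]
      _ ≤ _ := by rw [one_mul]; gcongr
  have tN : -2 * (v / x ^ 2) ≤ (ν * (1 / (2 + N) - 2)) * (v / x ^ 2) :=
    mul_le_mul_of_nonneg_right cN.1 (by positivity)
  have tg : 1 / 2 * (g - (1 + β / 2) ^ 2) * (u / x ^ 3) ≤ g / 2 * ((1 + v) / x ^ 3) := by
    have hg0 : 0 ≤ g := by
      refine le_trans ?_ hg
      positivity
    calc 1 / 2 * (g - (1 + β / 2) ^ 2) * (u / x ^ 3) ≤ g / 2 * (u / x ^ 3) := by
          gcongr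
          nlinarith [sq_nonneg (1 + β / 2)]
      _ ≤ _ := by gcongr
  have tv : N / (1 + N) * (v / x) ≤ (1 + v) / x ^ 3 :=
    (mul_le_of_le_one_left (by positivity) hN1).trans hvx
  have split2 : (1 + v) / x ^ 2 = 1 / x ^ 2 + v / x ^ 2 := add_div _ _ _
  have split3 : (1 + v) / x ^ 3 = 1 / x ^ 3 + v / x ^ 3 := add_div _ _ _
  have q3 : 0 < v / x ^ 3 := by positivity
  have hgl : (4 * X + 2 + (1 + N / 2) ^ 2) * ((1 + v) / x ^ 3) ≤ g / 2 * ((1 + v) / x ^ 3) :=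
    mul_le_mul_of_nonneg_right (by linarith) (by positivity)
  have tc : (g - (1 + N / 2) ^ 2) * ((1 + v) / x ^ 3) ≤
      (g - 1) * (1 / x ^ 3) + (g - (1 + N / 2) ^ 2) * (v / x ^ 3) := by
    rw [split3, mul_add]
    gcongr
    nlinarith
  have hXq : 0 ≤ X * ((1 + v) / x ^ 3) := by positivity
  have hfin : d / 2 * w ≤ d / 2 * (u / x) + (1 + v) / x ^ 3 := by
    have h1 : d / 2 * w ≤ d / 2 * (u / x) + d / 2 * (v / x ^ 3) := by
      rw [← mul_add]; gcongr
    have h2 : d / 2 * (v / x ^ 3) ≤ 1 * (v / x ^ 3) := by gcongr; linarith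
    rw [split3]; linarith
  have hux0 : 0 ≤ d * (u / x) := by positivity
  linarith only [hmid, t0, tN, tβ, tg, tv, tc, hgl, hXq, hfin, hux0, split2, split3]

/-- Crude bound: every correction is a constant times a quantity dominated by the density, with a
factor `1/x` or `1/x²`. It serves at both ends of the half-line, so `K` may depend on `k`. -/
theorem abs_virial_sub_le (ν k : ℝ) (ψ : ℝ → ℂ) {b : ℝ} (hb : 0 ≤ b) :
    ∃ K : ℝ, 0 ≤ K ∧ ∀ x : ℝ, 0 < x →
      |virial ν k b ψ x - x ^ (-b) * density ψ x| ≤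
        x ^ (-b) * (K * density ψ x * (1 / x + 1 / x ^ 2)) := by
  refine ⟨|k| + |ν| + |k * (1 + b) / 2| + |(1 + b) * (2 + b) / 4| + |k * ν * (1 + b) / (2 + b)| +
    |ν * (1 + b) / (2 + b)| + |ν * (1 + b) / (2 + b) * ν|, by positivity, fun x hx => ?_⟩
  have hy : 0 < x ^ (-b) := Real.rpow_pos_of_pos hx _
  have hM := density_nonneg ψ x
  have hD := abs_imbalance_le ψ x
  have hP := abs_crossTerm_le ψ x
  have hMM : |density ψ x| ≤ density ψ x := (abs_of_nonneg hM).le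
  set q := 1 / x + 1 / x ^ 2 with hq
  have hp1 : 0 < 1 / x := by positivity
  have hp2 : 0 < 1 / x ^ 2 := by positivity
  have key : ∀ c Z p : ℝ, |Z| ≤ density ψ x → 0 ≤ p → p ≤ q →
      |c * Z * p| ≤ |c| * density ψ x * q := by
    intro c Z p hZ hp hpq
    rw [abs_mul, abs_mul, abs_of_nonneg hp]
    gcongr
  have l1 : 1 / x ≤ q := by linarith
  have l2 : 1 / x ^ 2 ≤ q := by linarith
  have k1 := abs_le.1 (key k _ _ hP hp1.le l1)
  have k2 := abs_le.1 (key ν _ _ hMM hp1.le l1)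
  have k3 := abs_le.1 (key (k * (1 + b) / 2) _ _ hD hp2.le l2)
  have k4 := abs_le.1 (key ((1 + b) * (2 + b) / 4) _ _ hMM hp2.le l2)
  have k5 := abs_le.1 (key (k * ν * (1 + b) / (2 + b)) _ _ hP hp2.le l2)
  have k6 := abs_le.1 (key (ν * (1 + b) / (2 + b)) _ _ hMM hp1.le l1)
  have k7 := abs_le.1 (key (ν * (1 + b) / (2 + b) * ν) _ _ hMM hp2.le l2)
  have hb2 : 2 + b ≠ 0 := by positivity
  have e : virial ν k b ψ x - x ^ (-b) * density ψ x = x ^ (-b) *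
      (-(k * crossTerm ψ x * (1 / x)) + ν * density ψ x * (1 / x) +
        k * (1 + b) / 2 * imbalance ψ x * (1 / x ^ 2) +
        (1 + b) * (2 + b) / 4 * density ψ x * (1 / x ^ 2) -
        k * ν * (1 + b) / (2 + b) * crossTerm ψ x * (1 / x ^ 2) +
        ν * (1 + b) / (2 + b) * density ψ x * (1 / x) +
        ν * (1 + b) / (2 + b) * ν * density ψ x * (1 / x ^ 2)) := by
    unfold virial
    rw [← mul_sub]
    congr 1
    have := hx.ne'
    field_simp
    ring
  rw [e, abs_mul, abs_of_pos hy]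
  refine mul_le_mul_of_nonneg_left ?_ hy.le
  rw [abs_le]
  constructor
  · nlinarith [k1.1, k1.2]
  · nlinarith [k1.1, k1.2]

theorem tendsto_virial_atTop_zero {ν k m : ℝ} {ψ : ℝ → ℂ} (hm : Tendsto (density ψ) atTop (𝓝 m))
    {b : ℝ} (hb : 0 ≤ b) :
    Tendsto (fun x => virial ν k b ψ x - x ^ (-b) * density ψ x) atTop (𝓝 0) := by
  obtain ⟨K, hK, hbd⟩ := abs_virial_sub_le ν k ψ hb
  have hz : Tendsto (fun x : ℝ => K * density ψ x * (1 / x + 1 / x ^ 2)) atTop (𝓝 0) := by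
    have h1 : Tendsto (fun x : ℝ => 1 / x) atTop (𝓝 0) := tendsto_const_nhds.div_atTop tendsto_id
    have h2 : Tendsto (fun x : ℝ => 1 / x ^ 2) atTop (𝓝 0) :=
      tendsto_const_nhds.div_atTop (tendsto_pow_atTop two_ne_zero)
    simpa using (hm.const_mul K).mul (h1.add h2)
  refine squeeze_zero_norm' ?_ hz
  filter_upwards [eventually_ge_atTop 1] with x hx
  have hx0 : (0 : ℝ) < x := by linarith
  refine (hbd x hx0).trans (mul_le_of_le_one_left ?_ ?_)
  · have := density_nonneg ψ x
    positivity
  · exact Real.rpow_le_one_of_one_le_of_nonpos hx (by linarith)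

theorem tendsto_virial_atTop {ν k m : ℝ} {ψ : ℝ → ℂ} (hm : Tendsto (density ψ) atTop (𝓝 m))
    {b : ℝ} (hb : 0 < b) : Tendsto (virial ν k b ψ) atTop (𝓝 0) := by
  have h1 := (tendsto_virial_atTop_zero (ν := ν) (k := k) hm hb.le).add
    ((tendsto_rpow_neg_atTop hb).mul hm)
  simpa using h1

theorem tendsto_virial_nhdsGT {ν k C r : ℝ} {ψ : ℝ → ℂ}
    (hC : ∀ x : ℝ, 0 < x → x ≤ 1 → density ψ x ≤ C * x ^ r) {b : ℝ} (hb : 0 ≤ b)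
    (hr : 2 + b < r) : Tendsto (virial ν k b ψ) (𝓝[>] 0) (𝓝 0) := by
  obtain ⟨K, hK, hbd⟩ := abs_virial_sub_le ν k ψ hb
  have hz : Tendsto (fun x : ℝ => (1 + 2 * K) * C * x ^ (r - 2 - b)) (𝓝[>] 0) (𝓝 0) := by
    have h1 : Tendsto (fun x : ℝ => x ^ (r - 2 - b)) (𝓝[>] 0) (𝓝 (0 ^ (r - 2 - b))) :=
      (Real.continuousAt_rpow_const 0 _ (Or.inr (by linarith))).tendsto.mono_left
        nhdsWithin_le_nhds
    rw [Real.zero_rpow (by linarith)] at h1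
    simpa using h1.const_mul ((1 + 2 * K) * C)
  refine squeeze_zero_norm' ?_ hz
  filter_upwards [Ioc_mem_nhdsGT (show (0 : ℝ) < 1 by norm_num)] with x hx
  have hx0 : 0 < x := hx.1
  have hM := density_nonneg ψ x
  have hy : 0 < x ^ (-b) := Real.rpow_pos_of_pos hx0 _
  have hp : 1 ≤ 1 / x ^ 2 := by
    rw [le_div_iff₀ (by positivity)]; nlinarith [hx.2]
  have hp' : 1 / x ≤ 1 / x ^ 2 := by
    rw [div_le_div_iff₀ hx0 (by positivity)]; nlinarith [hx.2]
  have h1 : |virial ν k b ψ x| ≤ x ^ (-b) * (density ψ x) +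
      x ^ (-b) * (K * density ψ x * (1 / x + 1 / x ^ 2)) := by
    have h2 := hbd x hx0
    have h3 : |virial ν k b ψ x| ≤
        |x ^ (-b) * density ψ x| + |virial ν k b ψ x - x ^ (-b) * density ψ x| := by
      simpa using abs_add_le (x ^ (-b) * density ψ x)
        (virial ν k b ψ x - x ^ (-b) * density ψ x)
    rw [abs_of_nonneg (mul_nonneg hy.le hM)] at h3
    linarith
  rw [Real.norm_eq_abs]
  calc |virial ν k b ψ x| ≤ x ^ (-b) * (density ψ x * (1 / x ^ 2)) +
        x ^ (-b) * (K * density ψ x * (1 / x ^ 2 + 1 / x ^ 2)) := by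
        refine h1.trans ?_
        gcongr
        exact le_mul_of_one_le_right hM hp
    _ = (1 + 2 * K) * (x ^ (-b) * (1 / x ^ 2)) * density ψ x := by ring
    _ ≤ (1 + 2 * K) * (x ^ (-b) * (1 / x ^ 2)) * (C * x ^ r) := by
        gcongr; exact hC x hx0 hx.2
    _ = (1 + 2 * K) * C * x ^ (r - 2 - b) := by
        rw [show r - 2 - b = -b + -(2 : ℕ) + r by push_cast; ring, Real.rpow_add hx0,
          Real.rpow_add hx0, Real.rpow_neg hx0.le (2 : ℕ), Real.rpow_natCast]
        ring

/-- Morawetz-type bound for the moments of a radial solution in terms of its amplitude at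
infinity, uniform for large angular momentum. -/
theorem exists_integral_density_le {s : ℝ} (hs : 1 < s) :
    ∃ B g₀ : ℝ, 0 < B ∧ ∀ (ν k C m r : ℝ) (ψ : ℝ → ℂ), |ν| ≤ 1 → g₀ ≤ k ^ 2 - ν ^ 2 → g₀ ≤ r →
      IsRadialSolution ν k ψ → (∀ x : ℝ, 0 < x → x ≤ 1 → density ψ x ≤ C * x ^ r) →
      Tendsto (density ψ) atTop (𝓝 m) →
      ∫ x in Set.Ioi (0 : ℝ), density ψ x * x ^ (-s) ≤ B * m := by
  obtain ⟨β, N, η, ζ, δ, g₀, hβ, hN, hδ, hW⟩ := exists_le_virialWeight hs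
  -- `r ≥ 3 + N + β` exceeds `2 + b` for each of `b = 0, β, N`, so all three virial functions vanish
  -- at `0`.
  refine ⟨δ⁻¹, max g₀ (3 + N + β), by positivity, fun ν k C m r ψ hν hg hr h hC hm => ?_⟩
  have hg' : g₀ ≤ k ^ 2 - ν ^ 2 := (le_max_left _ _).trans hg
  have hr' : 3 + N + β ≤ r := (le_max_right _ _).trans hr
  set Φ : ℝ → ℝ := fun x => virial ν k 0 ψ x - η * virial ν k β ψ x + ζ * virial ν k N ψ x with hΦ
  set W : ℝ → ℝ := fun x => virialWeight ν k 0 x - η * virialWeight ν k β x +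
          ζ * virialWeight ν k N x with hWdef
  -- The formula for `Φ` need not have the right value at `0`; it is replaced there by its right
  -- limit `0`.
  have hd : ∀ x ∈ Set.Ioi (0 : ℝ), HasDerivAt (Function.update Φ 0 0) (density ψ x * W x) x := by
    intro x hx
    have h1 := ((h.hasDerivAt_virial le_rfl hx).sub
      ((h.hasDerivAt_virial hβ.le hx).const_mul η)).add
      ((h.hasDerivAt_virial (by linarith : 0 ≤ N) hx).const_mul ζ)
    have h2 : HasDerivAt Φ (density ψ x * W x) x := by
      refine h1.congr_deriv ?_
      simp only [hWdef]; ring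
    refine h2.congr_of_eventuallyEq ?_
    filter_upwards [lt_mem_nhds (Set.mem_Ioi.1 hx)] with y hy
    rw [Function.update_of_ne hy.ne']
  have hpos : ∀ x ∈ Set.Ioi (0 : ℝ), δ * (density ψ x * x ^ (-s)) ≤ density ψ x * W x := by
    intro x hx
    calc δ * (density ψ x * x ^ (-s)) = density ψ x * (δ * x ^ (-s)) := by ring
      _ ≤ _ := mul_le_mul_of_nonneg_left (hW ν k hν hg' x hx) (density_nonneg ψ x)
  have hnn : ∀ x ∈ Set.Ioi (0 : ℝ), 0 ≤ δ * (density ψ x * x ^ (-s)) := fun x hx =>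
    mul_nonneg hδ.le (mul_nonneg (density_nonneg ψ x) (Real.rpow_nonneg (le_of_lt hx) _))
  have hcont : ContinuousWithinAt (Function.update Φ 0 0) (Set.Ici 0) 0 := by
    rw [continuousWithinAt_update_same, Set.Ici_sdiff_left]
    have h1 := ((tendsto_virial_nhdsGT (ν := ν) (k := k) hC le_rfl (by linarith)).sub
      ((tendsto_virial_nhdsGT (ν := ν) (k := k) hC hβ.le (by linarith)).const_mul η)).add
      ((tendsto_virial_nhdsGT (ν := ν) (k := k) hC (b := N) (by linarith)
        (by linarith)).const_mul ζ)
    simpa using h1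
  -- Only exponent `0` contributes at infinity.
  have hlim : Tendsto (Function.update Φ 0 0) atTop (𝓝 m) := by
    have h0 : Tendsto (virial ν k 0 ψ) atTop (𝓝 m) := by
      simpa using (tendsto_virial_atTop_zero (ν := ν) (k := k) hm le_rfl).add hm
    have h1 := (h0.sub ((tendsto_virial_atTop (ν := ν) (k := k) hm hβ).const_mul η)).add
      ((tendsto_virial_atTop (ν := ν) (k := k) hm (b := N) (by linarith)).const_mul ζ)
    simp only [mul_zero, sub_zero, add_zero] at h1
    refine h1.congr' ?_
    filter_upwards [eventually_gt_atTop 0] with y hy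
    rw [Function.update_of_ne hy.ne']
  have hge : ∀ x ∈ Set.Ioi (0 : ℝ), 0 ≤ density ψ x * W x := fun x hx =>
    (hnn x hx).trans (hpos x hx)
  have hint := MeasureTheory.integrableOn_Ioi_deriv_of_nonneg hcont hd hge hlim
  have hval := MeasureTheory.integral_Ioi_of_hasDerivAt_of_nonneg hcont hd hge hlim
  rw [Function.update_self, sub_zero] at hval
  rw [← div_eq_inv_mul, le_div_iff₀ hδ, ← hval, mul_comm, ← MeasureTheory.integral_const_mul]
  exact MeasureTheory.integral_mono_of_nonneg
    ((MeasureTheory.ae_restrict_iff' measurableSet_Ioi).2 (Eventually.of_forall hnn)) hint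
    ((MeasureTheory.ae_restrict_iff' measurableSet_Ioi).2 (Eventually.of_forall hpos))

end Morawetz

/-! ### The amplitude at infinity through a Laplace-type transform. -/

theorem exists_norm_le_of_tendsto {f : ℝ → ℂ} (hf : ContinuousOn f (Set.Ici 0)) {l : ℂ}
    (hl : Tendsto f atTop (𝓝 l)) : ∃ C, 0 ≤ C ∧ ∀ x, 0 ≤ x → ‖f x‖ ≤ C := by
  have hev := hl.norm.eventually_le_const (lt_add_one ‖l‖)
  obtain ⟨X, hX⟩ := eventually_atTop.1 hev
  obtain ⟨C, hC⟩ := (isCompact_Icc (a := (0 : ℝ)) (b := X)).exists_bound_of_continuousOn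
    (hf.mono Set.Icc_subset_Ici_self)
  refine ⟨max C (‖l‖ + 1), le_max_of_le_right (by positivity), fun x hx => ?_⟩
  rcases le_total x X with h | h
  · exact (hC x ⟨hx, h⟩).trans (le_max_left _ _)
  · exact (hX x h).trans (le_max_right _ _)

/-- The Laplace-type transform of the confluent function against a Gamma weight. -/
noncomputable def gammaTransform (γ : ℝ) (f : ℝ → ℂ) (l : ℝ) : ℂ :=
  ∫ y in Set.Ioi (0 : ℝ), ((Real.exp (-y) * y ^ (2 * γ) : ℝ) : ℂ) * f (l * y)

theorem integrableOn_gammaWeight {r : ℝ} (hr : -1 < r) :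
    IntegrableOn (fun y : ℝ => Real.exp (-y) * y ^ r) (Set.Ioi 0) := by
  have := Real.GammaIntegral_convergent (s := r + 1) (by linarith)
  simpa using this

theorem continuousOn_gammaWeight (r : ℝ) :
    ContinuousOn (fun y : ℝ => ((Real.exp (-y) * y ^ r : ℝ) : ℂ)) (Set.Ioi 0) := by
  refine continuous_ofReal.comp_continuousOn ?_
  refine ContinuousOn.mul (by fun_prop) ?_
  exact fun y hy => (Real.continuousAt_rpow_const y r (Or.inl (ne_of_gt hy))).continuousWithinAt

theorem norm_gammaWeight (r : ℝ) {y : ℝ} (hy : 0 < y) :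
    ‖((Real.exp (-y) * y ^ r : ℝ) : ℂ)‖ = Real.exp (-y) * y ^ r := by
  rw [norm_real, Real.norm_of_nonneg (by positivity)]

theorem aestronglyMeasurable_gammaWeight_mul (r : ℝ) {f : ℝ → ℂ} (hf : Continuous f) (l : ℝ) :
    AEStronglyMeasurable (fun y : ℝ => ((Real.exp (-y) * y ^ r : ℝ) : ℂ) * f (l * y))
      (volume.restrict (Set.Ioi 0)) :=
  ((continuousOn_gammaWeight r).mul (by fun_prop)).aestronglyMeasurable measurableSet_Ioi

theorem integrable_gammaWeight_mul {r : ℝ} (hr : -1 < r) {f : ℝ → ℂ} (hf : Continuous f) {C : ℝ}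
    (hC : ∀ x, 0 ≤ x → ‖f x‖ ≤ C) {l : ℝ} (hl : 0 ≤ l) :
    IntegrableOn (fun y : ℝ => ((Real.exp (-y) * y ^ r : ℝ) : ℂ) * f (l * y)) (Set.Ioi 0) := by
  refine Integrable.mono' ((integrableOn_gammaWeight hr).mul_const C)
    (aestronglyMeasurable_gammaWeight_mul r hf l) ?_
  refine (ae_restrict_iff' measurableSet_Ioi).2 (Eventually.of_forall fun y (hy : 0 < y) => ?_)
  rw [norm_mul, norm_gammaWeight r hy]
  gcongr
  exact hC _ (by positivity)

theorem continuous_kummerDiff {γ : ℝ} (hγ : 0 ≤ γ) (ν : ℝ) : Continuous (kummerDiff γ ν) := by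
  have := continuous_kummer hγ ν
  have h2 : Continuous fun x => conj (kummer γ ν x) := continuous_conj.comp this
  unfold kummerDiff
  fun_prop

theorem norm_kummerDiff_le {γ ν C : ℝ} (hC : ∀ x, 0 ≤ x → ‖kummer γ ν x‖ ≤ C) {x : ℝ} (hx : 0 ≤ x) :
    ‖kummerDiff γ ν x‖ ≤ 2 * C := by
  have h1 : ‖exp (-2 * I * x)‖ = 1 := by
    rw [show -2 * I * (x : ℂ) = ((-2 * x : ℝ) : ℂ) * I by push_cast; ring, norm_exp_ofReal_mul_I]
  have := hC x hx
  calc ‖kummerDiff γ ν x‖ ≤ ‖exp (-2 * I * x) * conj (kummer γ ν x)‖ + ‖kummer γ ν x‖ :=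
        norm_sub_le _ _
    _ = ‖kummer γ ν x‖ + ‖kummer γ ν x‖ := by rw [norm_mul, h1, one_mul, RCLike.norm_conj]
    _ ≤ 2 * C := by linarith

theorem hasDerivAt_gammaTransform_kummer {γ ν C : ℝ} (hγ : 0 ≤ γ)
    (hC : ∀ x, 0 ≤ x → ‖kummer γ ν x‖ ≤ C) {l : ℝ} (hl : 0 < l) :
    HasDerivAt (gammaTransform γ (kummer γ ν))
      (((γ : ℂ) - I * ν) / l * gammaTransform γ (kummerDiff γ ν) l) l := by
  set a : ℂ := (γ : ℂ) - I * ν with ha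
  have hk := continuous_kummer hγ ν
  have hq := continuous_kummerDiff hγ ν
  have hC0 : 0 ≤ C := (norm_nonneg _).trans (hC 0 le_rfl)
  set F' : ℝ → ℝ → ℂ := fun t y =>
    ((Real.exp (-y) * y ^ (2 * γ) : ℝ) : ℂ) * (a / t * kummerDiff γ ν (t * y)) with hF'
  have key := hasDerivAt_integral_of_dominated_loc_of_deriv_le (μ := volume.restrict (Set.Ioi 0))
    (F := fun t y => ((Real.exp (-y) * y ^ (2 * γ) : ℝ) : ℂ) * kummer γ ν (t * y)) (F' := F')
    -- Staying above `l / 2` bounds the factor `1 / t` in the derivative uniformly.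
    (x₀ := l) (s := Set.Ioi (l / 2))
    (bound := fun y => Real.exp (-y) * y ^ (2 * γ) * (‖a‖ / (l / 2) * (2 * C)))
    (Ioi_mem_nhds (by linarith))
    (Eventually.of_forall fun t => aestronglyMeasurable_gammaWeight_mul _ hk t)
    (integrable_gammaWeight_mul (by linarith) hk hC hl.le)
    (aestronglyMeasurable_gammaWeight_mul (2 * γ) (f := fun x => a / l * kummerDiff γ ν x)
      (by fun_prop) l) ?_
    ((integrableOn_gammaWeight (by linarith)).mul_const _) ?_
  · refine key.2.congr_deriv ?_
    unfold gammaTransform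
    rw [← integral_const_mul]
    refine integral_congr_ae (Eventually.of_forall fun y => ?_)
    simp only [hF']; ring
  · refine (ae_restrict_iff' measurableSet_Ioi).2
      (Eventually.of_forall fun y (hy : 0 < y) t (ht : l / 2 < t) => ?_)
    have ht0 : 0 < t := by linarith
    simp only [hF']
    rw [norm_mul, norm_gammaWeight _ hy, norm_mul, norm_div, norm_real, Real.norm_of_nonneg ht0.le]
    have := norm_kummerDiff_le hC (x := t * y) (by positivity)
    gcongr
  · refine (ae_restrict_iff' measurableSet_Ioi).2
      (Eventually.of_forall fun y (hy : 0 < y) t (ht : l / 2 < t) => ?_)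
    have ht0 : 0 < t := by linarith
    have h1 : HasDerivAt (fun t : ℝ => t * y) y t := by simpa using (hasDerivAt_id t).mul_const y
    have h2 := (hasDerivAt_kummer hγ ν (x := t * y) (by positivity)).scomp t h1
    refine (h2.const_mul _).congr_deriv ?_
    simp only [hF']
    have : (t : ℂ) ≠ 0 := by exact_mod_cast ht0.ne'
    have : (y : ℂ) ≠ 0 := by exact_mod_cast hy.ne'
    rw [← ha, real_smul]
    push_cast
    field_simp

/-- Integration by parts. The weight `y ^ (2γ)` is the one whose derivative cancels the singular
term `-2γ kummerDiff / x` in the differential equation, so an algebraic relation between the two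
transforms remains. -/
theorem gammaTransform_kummerDiff {γ ν C : ℝ} (hγ : 0 < γ)
    (hC : ∀ x, 0 ≤ x → ‖kummer γ ν x‖ ≤ C) {l : ℝ} (hl : 0 < l) :
    (1 + 2 * I * l) * gammaTransform γ (kummerDiff γ ν) l
      = -(2 * I * l) * gammaTransform γ (kummer γ ν) l := by
  have hk := continuous_kummer hγ.le ν
  have hq := continuous_kummerDiff hγ.le ν
  have hC0 : 0 ≤ C := (norm_nonneg _).trans (hC 0 le_rfl)
  have hqb : ∀ x, 0 ≤ x → ‖kummerDiff γ ν x‖ ≤ 2 * C := fun x hx => norm_kummerDiff_le hC hx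
  have ik := integrable_gammaWeight_mul (r := 2 * γ) (by linarith) hk hC hl.le
  have iq := integrable_gammaWeight_mul (r := 2 * γ) (by linarith) hq hqb hl.le
  set w : ℝ → ℂ := fun y => ((Real.exp (-y) * y ^ (2 * γ) : ℝ) : ℂ) with hw
  have hw' : ∀ y : ℝ, 0 < y → HasDerivAt w (-w y + 2 * γ * w y / y) y := by
    intro y hy
    have h1 : HasDerivAt (fun y : ℝ => Real.exp (-y) * y ^ (2 * γ))
        (-Real.exp (-y) * y ^ (2 * γ) + Real.exp (-y) * (2 * γ * y ^ (2 * γ - 1))) y := by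
      have h2 := (hasDerivAt_neg y).exp
      refine (h2.mul (Real.hasDerivAt_rpow_const (Or.inl hy.ne'))).congr_deriv ?_
      ring
    refine h1.ofReal_comp.congr_deriv ?_
    rw [Real.rpow_sub_one hy.ne']
    simp only [hw]
    push_cast
    ring
  have hG : ∀ y ∈ Set.Ioi (0 : ℝ), HasDerivAt (fun y => w y * kummerDiff γ ν (l * y))
      (-(w y * kummerDiff γ ν (l * y)) - 2 * I * l * (w y * kummer γ ν (l * y)) -
        2 * I * l * (w y * kummerDiff γ ν (l * y))) y := by
    intro y (hy : 0 < y)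
    have h1 : HasDerivAt (fun t : ℝ => l * t) l y := by simpa using (hasDerivAt_id y).const_mul l
    have h2 := (hasDerivAt_kummerDiff hγ.le ν (x := l * y) (by positivity)).scomp y h1
    refine ((hw' y hy).mul h2).congr_deriv ?_
    have : (l : ℂ) ≠ 0 := by exact_mod_cast hl.ne'
    have : (y : ℂ) ≠ 0 := by exact_mod_cast hy.ne'
    rw [real_smul]
    simp only [Function.comp]
    push_cast
    field_simp
    ring
  have hint : IntegrableOn (fun y => -(w y * kummerDiff γ ν (l * y)) -
      2 * I * l * (w y * kummer γ ν (l * y)) -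
        2 * I * l * (w y * kummerDiff γ ν (l * y))) (Set.Ioi 0) :=
    (iq.neg.sub (ik.const_mul _)).sub (iq.const_mul _)
  have hcont : ContinuousWithinAt (fun y => w y * kummerDiff γ ν (l * y)) (Set.Ici 0) 0 := by
    have : Continuous w := by
      refine continuous_ofReal.comp ?_
      exact (by fun_prop : Continuous fun y : ℝ => Real.exp (-y)).mul
        (Real.continuous_rpow_const (by linarith))
    exact (this.mul (by fun_prop)).continuousAt.continuousWithinAt
  have hlim : Tendsto (fun y => w y * kummerDiff γ ν (l * y)) atTop (𝓝 0) := by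
    have h1 : Tendsto (fun y : ℝ => y ^ (2 * γ) * Real.exp (-1 * y) * (2 * C)) atTop (𝓝 0) := by
      simpa using (tendsto_rpow_mul_exp_neg_mul_atTop_nhds_zero (2 * γ) 1 one_pos).mul_const (2 * C)
    refine squeeze_zero_norm' ?_ h1
    filter_upwards [eventually_gt_atTop 0] with y hy
    simp only [hw]
    rw [norm_mul, norm_gammaWeight _ hy, neg_one_mul, mul_comm (y ^ (2 * γ))]
    gcongr
    exact hqb _ (by positivity)
  have hval := integral_Ioi_of_hasDerivAt_of_tendsto hcont hG hint hlim
  have hw0 : w 0 = 0 := by simp [hw, hγ.ne']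
  rw [hw0, zero_mul, sub_zero, integral_sub, integral_sub, integral_neg,
    integral_const_mul, integral_const_mul] at hval
  · change -gammaTransform γ (kummerDiff γ ν) l - 2 * I * l * gammaTransform γ (kummer γ ν) l -
      2 * I * l * gammaTransform γ (kummerDiff γ ν) l = 0 at hval
    linear_combination -hval
  · exact iq.neg
  · exact ik.const_mul _
  · exact iq.neg.sub (ik.const_mul _)
  · exact iq.const_mul _

theorem tendsto_gammaTransform_kummer {γ ν C : ℝ} (hγ : 0 ≤ γ)
    (hC : ∀ x, 0 ≤ x → ‖kummer γ ν x‖ ≤ C) :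
    Tendsto (gammaTransform γ (kummer γ ν)) (𝓝[>] 0) (𝓝 (Real.Gamma (2 * γ + 1) : ℝ)) := by
  have hk := continuous_kummer hγ ν
  have hval : ((Real.Gamma (2 * γ + 1) : ℝ) : ℂ) =
      ∫ y in Set.Ioi (0 : ℝ), ((Real.exp (-y) * y ^ (2 * γ) : ℝ) : ℂ) * 1 := by
    simp only [mul_one]
    rw [integral_complex_ofReal, Real.Gamma_eq_integral (by linarith)]
    simp
  rw [hval]
  refine tendsto_integral_filter_of_dominated_convergence
    (fun y => Real.exp (-y) * y ^ (2 * γ) * C)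
    (Eventually.of_forall fun t => aestronglyMeasurable_gammaWeight_mul _ hk t) ?_
    ((integrableOn_gammaWeight (by linarith)).mul_const C) ?_
  · filter_upwards [self_mem_nhdsWithin] with l (hl : 0 < l)
    refine (ae_restrict_iff' measurableSet_Ioi).2 (Eventually.of_forall fun y (hy : 0 < y) => ?_)
    rw [norm_mul, norm_gammaWeight _ hy]
    gcongr
    exact hC _ (by positivity)
  · refine Eventually.of_forall fun y => ?_
    refine tendsto_const_nhds.mul ?_
    have h1 : Tendsto (fun l : ℝ => kummer γ ν (l * y)) (𝓝 0) (𝓝 (kummer γ ν (0 * y))) :=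
      (by fun_prop : Continuous fun l : ℝ => kummer γ ν (l * y)).tendsto 0
    rw [zero_mul, kummer_zero] at h1
    exact h1.mono_left nhdsWithin_le_nhds

/-- The two preceding relations give a linear equation in `l` for the transform, solved by a
multiple of `(1 + 2il) ^ (-a)` with `a = γ - iν`. The limit `l → 0` identifies the multiple as `Γ(2γ
+ 1)`. -/
theorem gammaTransform_kummer {γ ν C : ℝ} (hγ : 0 < γ)
    (hC : ∀ x, 0 ≤ x → ‖kummer γ ν x‖ ≤ C) {l : ℝ} (hl : 0 < l) :
    gammaTransform γ (kummer γ ν) l * (1 + 2 * I * l) ^ ((γ : ℂ) - I * ν)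
      = (Real.Gamma (2 * γ + 1) : ℝ) := by
  set a : ℂ := (γ : ℂ) - I * ν with ha
  set g : ℝ → ℂ := fun t => gammaTransform γ (kummer γ ν) t * (1 + 2 * I * t) ^ a with hg
  have hslit : ∀ t : ℝ, 1 + 2 * I * (t : ℂ) ∈ slitPlane := fun t => Or.inl (by simp)
  have hp : ∀ t : ℝ, HasDerivAt (fun t : ℝ => (1 + 2 * I * (t : ℂ)) ^ a)
      (a * (1 + 2 * I * t) ^ (a - 1) * (2 * I)) t := by
    intro t
    have h1 : HasDerivAt (fun z : ℂ => 1 + 2 * I * z) (2 * I) (t : ℂ) := by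
      simpa using ((hasDerivAt_id (t : ℂ)).const_mul (2 * I)).const_add 1
    exact (h1.cpow_const (hslit t)).comp_ofReal
  have hg' : ∀ t ∈ Set.Ioi (0 : ℝ), HasDerivAt g 0 t := by
    intro t (ht : 0 < t)
    refine ((hasDerivAt_gammaTransform_kummer hγ.le hC ht).mul (hp t)).congr_deriv ?_
    have h0 := slitPlane_ne_zero (hslit t)
    have ht' : (t : ℂ) ≠ 0 := by exact_mod_cast ht.ne'
    rw [cpow_sub a 1 h0, cpow_one, ← ha]
    have h2 := gammaTransform_kummerDiff hγ hC ht
    generalize 1 + 2 * I * (t : ℂ) = w at h0 h2 ⊢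
    clear_value a
    field_simp
    linear_combination a * w ^ a * h2
  have hconst : ∀ t ∈ Set.Ioi (0 : ℝ), g t = g l := fun t ht =>
    isOpen_Ioi.is_const_of_deriv_eq_zero isPreconnected_Ioi
      (fun x hx => (hg' x hx).differentiableAt.differentiableWithinAt)
      (fun x hx => (hg' x hx).deriv) ht hl
  have hlim : Tendsto g (𝓝[>] 0) (𝓝 ((Real.Gamma (2 * γ + 1) : ℝ) * 1)) := by
    refine (tendsto_gammaTransform_kummer hγ.le hC).mul ?_
    have h1 := ((hp 0).continuousAt.tendsto).mono_left (nhdsWithin_le_nhds (s := Set.Ioi 0))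
    simpa using h1
  have hlim2 : Tendsto g (𝓝[>] 0) (𝓝 (g l)) := by
    refine tendsto_const_nhds.congr' ?_
    filter_upwards [self_mem_nhdsWithin] with t ht
    exact (hconst t ht).symm
  rw [mul_one] at hlim
  exact tendsto_nhds_unique hlim2 hlim

/-- The modulus of the leading coefficient of the confluent function at infinity. -/
theorem norm_limit_kummer {γ ν : ℝ} (hγ : 0 < γ) {L : ℂ}
    (hL : Tendsto (fun x : ℝ => (x : ℂ) ^ ((γ : ℂ) - I * ν) * kummer γ ν x) atTop (𝓝 L)) :
    ‖L‖ * ‖Gamma ((γ : ℂ) + 1 + I * ν)‖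
      = Real.Gamma (2 * γ + 1) * (2 ^ (-γ) * Real.exp (-(Real.pi * ν / 2))) := by
  set a : ℂ := (γ : ℂ) - I * ν with ha
  have hare : a.re = γ := by simp [ha]
  have haim : a.im = -ν := by simp [ha]
  have hk := continuous_kummer hγ.le ν
  have hpc : Continuous fun x : ℝ => (x : ℂ) ^ a :=
    continuous_ofReal_cpow_const (by rw [hare]; exact hγ)
  obtain ⟨C', hC'0, hC'⟩ := exists_norm_le_of_tendsto (hpc.mul hk).continuousOn hL
  obtain ⟨C, hC0, hC⟩ : ∃ C, 0 ≤ C ∧ ∀ x, 0 ≤ x → ‖kummer γ ν x‖ ≤ C := by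
    refine exists_norm_le_of_tendsto hk.continuousOn (l := 0) ?_
    have hz : Tendsto (fun x : ℝ => C' * x ^ (-γ)) atTop (𝓝 0) := by
      simpa using (tendsto_rpow_neg_atTop hγ).const_mul C'
    refine squeeze_zero_norm' ?_ hz
    filter_upwards [eventually_gt_atTop 0] with x hx
    have h1 := hC' x hx.le
    rw [Pi.mul_apply, norm_mul, norm_cpow_eq_rpow_re_of_pos hx, hare] at h1
    rw [Real.rpow_neg hx.le, ← div_eq_mul_inv, le_div_iff₀ (by positivity), mul_comm]
    exact h1
  -- Abelian step: moving `l ^ a` inside gives `∫ e^{-y} y^{2γ-a} (ly)^a kummer(ly) dy`. The last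
  -- factors tend to `L` boundedly, and `2γ - a = γ + iν` produces the Gamma value.
  have hlimit : Tendsto (fun l : ℝ => (l : ℂ) ^ a * gammaTransform γ (kummer γ ν) l) atTop
      (𝓝 (L * Gamma ((γ : ℂ) + 1 + I * ν))) := by
    have hval : L * Gamma ((γ : ℂ) + 1 + I * ν) = ∫ y in Set.Ioi (0 : ℝ),
        ((Real.exp (-y) * y ^ (2 * γ) : ℝ) : ℂ) * (y : ℂ) ^ (-a) * L := by
      rw [integral_mul_const, Gamma_eq_integral (by simp; linarith), mul_comm]
      congr 1
      unfold GammaIntegral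
      refine setIntegral_congr_fun measurableSet_Ioi fun y (hy : 0 < y) => ?_
      have hy' : (y : ℂ) ≠ 0 := by exact_mod_cast hy.ne'
      rw [ofReal_mul, ofReal_cpow hy.le, mul_assoc, ← cpow_add _ _ hy']
      congr 2
      simp only [ha]; push_cast; ring
    have hfun : ∀ l : ℝ, 0 < l → (l : ℂ) ^ a * gammaTransform γ (kummer γ ν) l =
        ∫ y in Set.Ioi (0 : ℝ), ((Real.exp (-y) * y ^ (2 * γ) : ℝ) : ℂ) * (y : ℂ) ^ (-a) *
          (((l * y : ℝ) : ℂ) ^ a * kummer γ ν (l * y)) := by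
      intro l hl
      unfold gammaTransform
      rw [← integral_const_mul]
      refine setIntegral_congr_fun measurableSet_Ioi fun y (hy : 0 < y) => ?_
      have hy' : (y : ℂ) ≠ 0 := by exact_mod_cast hy.ne'
      have hya : (y : ℂ) ^ a ≠ 0 := by
        rw [Ne, cpow_eq_zero_iff]; tauto
      rw [ofReal_mul l y, mul_cpow_ofReal_nonneg hl.le hy.le, cpow_neg]
      field_simp
    rw [hval]
    refine Tendsto.congr' (f₁ := fun l : ℝ => ∫ y in Set.Ioi (0 : ℝ),
        ((Real.exp (-y) * y ^ (2 * γ) : ℝ) : ℂ) * (y : ℂ) ^ (-a) *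
          (((l * y : ℝ) : ℂ) ^ a * kummer γ ν (l * y))) ?_ ?_
    · filter_upwards [eventually_gt_atTop 0] with l hl
      exact (hfun l hl).symm
    refine tendsto_integral_filter_of_dominated_convergence
      (fun y => Real.exp (-y) * y ^ γ * C') ?_ ?_
      ((integrableOn_gammaWeight (by linarith)).mul_const C') ?_
    · refine Eventually.of_forall fun l => ?_
      refine ContinuousOn.aestronglyMeasurable ?_ measurableSet_Ioi
      refine ((continuousOn_gammaWeight (2 * γ)).mul ?_).mul ?_
      · exact fun y (hy : 0 < y) =>
          (continuousAt_ofReal_cpow_const y (-a) (Or.inr hy.ne')).continuousWithinAt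
      · exact ((hpc.comp (continuous_const.mul continuous_id)).mul (by fun_prop)).continuousOn
    · filter_upwards [eventually_gt_atTop 0] with l hl
      refine (ae_restrict_iff' measurableSet_Ioi).2 (Eventually.of_forall fun y (hy : 0 < y) => ?_)
      rw [norm_mul, norm_mul, norm_gammaWeight _ hy, norm_cpow_eq_rpow_re_of_pos hy, neg_re, hare,
        mul_assoc (Real.exp (-y)), ← Real.rpow_add hy, show 2 * γ + -γ = γ by ring]
      gcongr
      exact hC' _ (by positivity)
    · refine (ae_restrict_iff' measurableSet_Ioi).2 (Eventually.of_forall fun y (hy : 0 < y) => ?_)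
      refine tendsto_const_nhds.mul ?_
      exact hL.comp (tendsto_id.atTop_mul_const hy)
  have hnorm : ∀ l : ℝ, 0 < l → ‖(l : ℂ) ^ a * gammaTransform γ (kummer γ ν) l‖ =
      Real.Gamma (2 * γ + 1) *
        (‖((l⁻¹ : ℝ) : ℂ) + 2 * I‖ ^ (-γ) * Real.exp (-(arg (((l⁻¹ : ℝ) : ℂ) + 2 * I) * ν))) := by
    intro l hl
    have hl' : (l : ℂ) ≠ 0 := by exact_mod_cast hl.ne'
    -- With `l` factored out, the remaining number tends to `2i`; its modulus yields `2 ^ (-γ)` and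
    -- its argument `π/2` yields `exp (-πν/2)`.
    have hz : (1 : ℂ) + 2 * I * l = l * (((l⁻¹ : ℝ) : ℂ) + 2 * I) := by
      push_cast; field_simp
    set z : ℂ := ((l⁻¹ : ℝ) : ℂ) + 2 * I with hzdef
    have hz0 : z ≠ 0 := by
      intro h
      have := congrArg Complex.im h
      simp [hzdef] at this
    have h1 := congrArg norm (gammaTransform_kummer hγ hC hl)
    rw [norm_mul, norm_real, Real.norm_of_nonneg (Real.Gamma_nonneg_of_nonneg (by linarith)), hz,
      norm_cpow_of_ne_zero (mul_ne_zero hl' hz0), arg_real_mul _ hl, norm_mul, norm_real,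
      Real.norm_of_nonneg hl.le, ← ha, hare, haim, Real.mul_rpow hl.le (norm_nonneg _)] at h1
    rw [norm_mul, norm_cpow_eq_rpow_re_of_pos hl, hare, ← h1, Real.rpow_neg (norm_nonneg _),
      Real.exp_neg, mul_neg, Real.exp_neg]
    have : ‖z‖ ^ γ ≠ 0 := (Real.rpow_pos_of_pos (norm_pos_iff.2 hz0) _).ne'
    field_simp
  have hz : Tendsto (fun l : ℝ => ((l⁻¹ : ℝ) : ℂ) + 2 * I) atTop (𝓝 (2 * I)) := by
    have : Tendsto (fun l : ℝ => ((l⁻¹ : ℝ) : ℂ) + 2 * I) atTop (𝓝 (((0 : ℝ) : ℂ) + 2 * I)) :=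
      ((continuous_ofReal.tendsto 0).comp tendsto_inv_atTop_zero).add_const _
    simpa using this
  have harg : Tendsto (fun l : ℝ => arg (((l⁻¹ : ℝ) : ℂ) + 2 * I)) atTop (𝓝 (Real.pi / 2)) := by
    have h2 : arg (2 * I) = Real.pi / 2 := by
      have := arg_real_mul I (r := 2) two_pos
      rw [arg_I] at this
      simpa using this
    rw [← h2]
    exact (continuousAt_arg (Or.inr (by simp))).tendsto.comp hz
  have hlim2 : Tendsto (fun l : ℝ => ‖(l : ℂ) ^ a * gammaTransform γ (kummer γ ν) l‖) atTop
      (𝓝 (Real.Gamma (2 * γ + 1) * (‖2 * I‖ ^ (-γ) * Real.exp (-(Real.pi / 2 * ν))))) := by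
    have h3 : Tendsto (fun l : ℝ => Real.Gamma (2 * γ + 1) *
        (‖((l⁻¹ : ℝ) : ℂ) + 2 * I‖ ^ (-γ) * Real.exp (-(arg (((l⁻¹ : ℝ) : ℂ) + 2 * I) * ν)))) atTop
        (𝓝 (Real.Gamma (2 * γ + 1) * (‖2 * I‖ ^ (-γ) * Real.exp (-(Real.pi / 2 * ν))))) :=
      ((hz.norm.rpow_const (Or.inl (by simp))).mul
        ((Real.continuous_exp.tendsto _).comp (harg.mul_const ν).neg)).const_mul _
    refine h3.congr' ?_
    filter_upwards [eventually_gt_atTop 0] with l hl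
    exact (hnorm l hl).symm
  have := tendsto_nhds_unique hlimit.norm hlim2
  rw [norm_mul] at this
  rw [this]
  have h2I : ‖2 * I‖ = 2 := by simp
  rw [h2I, show Real.pi / 2 * ν = Real.pi * ν / 2 by ring]

/-! ### The normalized radial waves. -/

theorem gam_sq {ν k : ℝ} (h : |ν| < |k|) : gam ν k ^ 2 = k ^ 2 - ν ^ 2 :=
  Real.sq_sqrt (sub_nonneg.2 (sq_le_sq.2 h.le))

theorem gam_pos {ν k : ℝ} (h : |ν| < |k|) : 0 < gam ν k :=
  Real.sqrt_pos.2 (sub_pos.2 (sq_lt_sq.2 h))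

theorem exp_phase_mul {ν k : ℝ} (h : |ν| < |k|) :
    exp (2 * I * phase ν k) * ((gam ν k : ℂ) - I * ν) = k := by
  have hk : (k : ℂ) ≠ 0 := by
    have : k ≠ 0 := abs_pos.1 ((abs_nonneg ν).trans_lt h)
    exact_mod_cast this
  set z : ℂ := ((gam ν k : ℂ) - I * ν) / k with hz
  have hnorm : ‖z‖ = 1 := by
    have h1 : ‖(gam ν k : ℂ) - I * ν‖ ^ 2 = ‖(k : ℂ)‖ ^ 2 := by
      rw [Complex.sq_norm, normSq_apply, norm_real, Real.norm_eq_abs, sq_abs]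
      simp
      nlinarith [gam_sq h]
    rw [hz, norm_div, (sq_eq_sq₀ (norm_nonneg _) (norm_nonneg _)).1 h1,
      div_self (norm_ne_zero_iff.2 hk)]
  have h2 := norm_mul_exp_arg_mul_I z
  rw [hnorm, ofReal_one, one_mul] at h2
  have h3 : exp (2 * I * phase ν k) * z = 1 := by
    have h4 : exp (2 * I * phase ν k) * z = exp (2 * I * phase ν k) * exp (z.arg * I) := by
      rw [h2]
    have h5 : phase ν k = -z.arg / 2 := rfl
    rw [h4, ← exp_add, h5, ← exp_zero]
    congr 1
    push_cast
    ring
  have h4 : (gam ν k : ℂ) - I * ν = z * k := by rw [hz, div_mul_cancel₀ _ hk]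
  rw [h4, ← mul_assoc, h3, one_mul]

/-- The normalization constant of the radial components. -/
noncomputable def normalization (ν k : ℝ) : ℝ :=
  √2 * ‖Gamma ((gam ν k : ℂ) + 1 + I * (ν : ℂ))‖ / Real.Gamma (2 * gam ν k + 1) *
    Real.exp (Real.pi * ν / 2)

/-- The normalized radial wave, without the volume factor. -/
noncomputable def radialWave (ν k x : ℝ) : ℂ :=
  ((normalization ν k * (2 * x) ^ gam ν k : ℝ) : ℂ) * wave ν k x

theorem wave_eq (ν k x : ℝ) :
    wave ν k x = exp (I * ((x : ℂ) + phase ν k)) * kummer (gam ν k) ν x := rfl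

/-- The power contributes `γ/x` and the confluent derivative `-(γ - iν)/x`, together the Coulomb
term `iν/x`. The phase shift turns the complex coefficient `γ - iν` of the conjugate term into the
real number `k`. -/
theorem isRadialSolution_radialWave {ν k : ℝ} (h : |ν| < |k|) :
    IsRadialSolution ν k (radialWave ν k) := by
  intro x hx
  have hγ := gam_pos h
  set γ := gam ν k with hγdef
  set A := normalization ν k with hA
  have hx' : (x : ℂ) ≠ 0 := by exact_mod_cast hx.ne'
  have hw : HasDerivAt (fun y : ℝ => ((A * (2 * y) ^ γ : ℝ) : ℂ))
      ((γ : ℂ) / x * ((A * (2 * x) ^ γ : ℝ) : ℂ)) x := by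
    have h1 : HasDerivAt (fun y : ℝ => 2 * y) 2 x := by simpa using (hasDerivAt_id x).const_mul 2
    have h2 := (h1.rpow_const (p := γ) (Or.inl (by positivity))).const_mul A
    refine h2.ofReal_comp.congr_deriv ?_
    rw [Real.rpow_sub_one (by positivity)]
    push_cast
    field_simp
  have he : HasDerivAt (fun y : ℝ => exp (I * ((y : ℂ) + phase ν k)))
      (exp (I * ((x : ℂ) + phase ν k)) * (I * 1)) x :=
    (((ofRealCLM.hasDerivAt (x := x)).add_const _).const_mul I).cexp
  have hf := hasDerivAt_kummer hγ.le ν hx.ne'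
  refine (hw.mul (he.mul hf)).congr_deriv ?_
  have hconj : conj (radialWave ν k x) = ((A * (2 * x) ^ γ : ℝ) : ℂ) *
      (exp (-(I * ((x : ℂ) + phase ν k))) * conj (kummer γ ν x)) := by
    rw [radialWave, wave_eq, map_mul, map_mul, conj_ofReal, ← exp_conj]
    simp [← hγdef, ← hA]
  have hψ : radialWave ν k x = ((A * (2 * x) ^ γ : ℝ) : ℂ) *
      (exp (I * ((x : ℂ) + phase ν k)) * kummer γ ν x) := rfl
  have hph : exp (I * ((x : ℂ) + phase ν k)) * ((γ : ℂ) - I * ν) * exp (-2 * I * x) =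
      k * exp (-(I * ((x : ℂ) + phase ν k))) := by
    have h3 : exp (I * ((x : ℂ) + phase ν k)) * exp (-2 * I * x) =
        exp (2 * I * phase ν k) * exp (-(I * ((x : ℂ) + phase ν k))) := by
      rw [← exp_add, ← exp_add]; congr 1; ring
    rw [← exp_phase_mul h]
    linear_combination ((γ : ℂ) - I * ν) * h3
  rw [hconj, hψ]
  simp only [Pi.mul_apply, kummerDiff]
  generalize ((A * (2 * x) ^ γ : ℝ) : ℂ) = w
  generalize exp (-2 * I * x) = E at hph ⊢
  field_simp
  linear_combination w * conj (kummer γ ν x) * hph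

/-- Unwinding the Coulomb phase turns the wave into a constant times `x ^ (γ - iν)` times the
confluent factor, whose limiting modulus is known. The Gamma, exponential and power factors of the
normalization cancel it exactly, and the remaining `√2` is squared. -/
theorem tendsto_density_radialWave {ν k : ℝ} (h : |ν| < |k|) :
    Tendsto (density (radialWave ν k)) atTop (𝓝 2) := by
  have hγ := gam_pos h
  obtain ⟨L, hL⟩ := (isRadialSolution_radialWave h).exists_tendsto_unwound
  have hΓ : Gamma ((gam ν k : ℂ) + 1 + I * (ν : ℂ)) ≠ 0 :=
    Gamma_ne_zero_of_re_pos (by simp; linarith)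
  have hΓ' : 0 < Real.Gamma (2 * gam ν k + 1) := Real.Gamma_pos_of_pos (by linarith)
  have hApos : 0 < normalization ν k := by
    unfold normalization
    have := norm_pos_iff.2 hΓ
    positivity
  set c : ℂ := ((normalization ν k * 2 ^ gam ν k : ℝ) : ℂ) * exp (I * phase ν k) with hc
  have hcn : ‖c‖ = normalization ν k * 2 ^ gam ν k := by
    rw [hc, norm_mul, mul_comm I, norm_exp_ofReal_mul_I, mul_one, norm_real,
      Real.norm_of_nonneg (by positivity)]
  have hc0 : c ≠ 0 := by
    rw [← norm_pos_iff, hcn]; positivity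
  have hfac : ∀ x : ℝ, 0 < x → exp (-I * (x + ν * Real.log x)) * radialWave ν k x =
      c * ((x : ℂ) ^ ((gam ν k : ℂ) - I * ν) * kummer (gam ν k) ν x) := by
    intro x hx
    have hx' : (x : ℂ) ≠ 0 := by exact_mod_cast hx.ne'
    have h1 : (x : ℂ) ^ ((gam ν k : ℂ) - I * ν) =
        ((x ^ gam ν k : ℝ) : ℂ) * exp (-I * (ν * Real.log x)) := by
      rw [cpow_sub _ _ hx', ofReal_cpow hx.le, cpow_def_of_ne_zero hx' (I * ν), ← ofReal_log hx.le,
        div_eq_mul_inv, ← exp_neg]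
      congr 2; ring
    have h2 : exp (-I * (x + ν * Real.log x)) * exp (I * ((x : ℂ) + phase ν k)) =
        exp (I * phase ν k) * exp (-I * (ν * Real.log x)) := by
      rw [← exp_add, ← exp_add]; congr 1; ring
    rw [h1, radialWave, wave_eq, hc, Real.mul_rpow two_pos.le hx.le]
    push_cast
    linear_combination ((normalization ν k : ℂ) * ((2 ^ gam ν k : ℝ) : ℂ) *
      ((x ^ gam ν k : ℝ) : ℂ) * kummer (gam ν k) ν x) * h2
  have hL' : Tendsto (fun x : ℝ => (x : ℂ) ^ ((gam ν k : ℂ) - I * ν) * kummer (gam ν k) ν x) atTop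
      (𝓝 (c⁻¹ * L)) := by
    refine (hL.const_mul c⁻¹).congr' ?_
    filter_upwards [eventually_gt_atTop 0] with x hx
    rw [hfac x hx, inv_mul_cancel_left₀ hc0]
  have hn := norm_limit_kummer hγ hL'
  have hLn : ‖L‖ = √2 := by
    rw [norm_mul, norm_inv, hcn, Real.rpow_neg two_pos.le, Real.exp_neg] at hn
    have h2 : (0 : ℝ) < 2 ^ gam ν k := by positivity
    have h3 := norm_pos_iff.2 hΓ
    have h4 := Real.exp_pos (Real.pi * ν / 2)
    rw [normalization] at hn
    field_simp at hn
    exact hn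
  have hsq : Tendsto (fun x : ℝ => ‖exp (-I * (x + ν * Real.log x)) * radialWave ν k x‖ ^ 2) atTop
      (𝓝 (‖L‖ ^ 2)) := hL.norm.pow 2
  rw [hLn, Real.sq_sqrt two_pos.le] at hsq
  refine hsq.congr fun x => ?_
  rw [density_eq_norm_sq, norm_mul,
    show -I * ((x : ℂ) + ν * Real.log x) = ((-(x + ν * Real.log x) : ℝ) : ℂ) * I by push_cast; ring,
    norm_exp_ofReal_mul_I, one_mul]

theorem exists_density_radialWave_le {ν k : ℝ} (h : |ν| < |k|) :
    ∃ C : ℝ, ∀ x : ℝ, 0 < x → x ≤ 1 → density (radialWave ν k) x ≤ C * x ^ (2 * gam ν k) := by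
  have hγ := gam_pos h
  obtain ⟨C, hC⟩ := (isCompact_Icc (a := (0 : ℝ)) (b := 1)).exists_bound_of_continuousOn
    (continuous_kummer hγ.le ν).continuousOn
  refine ⟨(normalization ν k * 2 ^ gam ν k) ^ 2 * C ^ 2, fun x hx hx1 => ?_⟩
  have h1 : ‖wave ν k x‖ ≤ C := by
    have e : I * ((x : ℂ) + phase ν k) = ((x + phase ν k : ℝ) : ℂ) * I := by push_cast; ring
    rw [wave_eq, norm_mul, e, norm_exp_ofReal_mul_I, one_mul]
    exact hC x ⟨hx.le, hx1⟩
  have h2 : x ^ (2 * gam ν k) = (x ^ gam ν k) ^ 2 := by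
    rw [mul_comm, Real.rpow_mul hx.le]; norm_cast
  rw [density_eq_norm_sq, radialWave, norm_mul, norm_real, Real.norm_eq_abs, mul_pow, sq_abs,
    Real.mul_rpow two_pos.le hx.le, h2]
  calc (normalization ν k * (2 ^ gam ν k * x ^ gam ν k)) ^ 2 * ‖wave ν k x‖ ^ 2
      ≤ (normalization ν k * (2 ^ gam ν k * x ^ gam ν k)) ^ 2 * C ^ 2 := by gcongr
    _ = _ := by ring

/-- The bound `x ^ (2γ)` near `0` calls for `s < 2γ + 1`, and mere boundedness at infinity for `s >
1`. -/
theorem integrableOn_density_radialWave {ν k s : ℝ} (h : |ν| < |k|) (hs : 1 < s)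
    (hs' : s < 2 * gam ν k + 1) :
    IntegrableOn (fun x => density (radialWave ν k) x * x ^ (-s)) (Set.Ioi 0) := by
  have hsol := isRadialSolution_radialWave h
  obtain ⟨C, hC⟩ := exists_density_radialWave_le h
  obtain ⟨D, X, hX, hD, hb⟩ := hsol.exists_bound
  have hrp : ContinuousOn (fun x : ℝ => x ^ (-s)) (Set.Ioi 0) := fun x (hx : 0 < x) =>
    (Real.continuousAt_rpow_const x (-s) (Or.inl hx.ne')).continuousWithinAt
  have hcont : ContinuousOn (fun x => density (radialWave ν k) x * x ^ (-s)) (Set.Ioi 0) :=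
    hsol.continuousOn_density.mul hrp
  have h1 : IntegrableOn (fun x => density (radialWave ν k) x * x ^ (-s)) (Set.Ioc 0 1) := by
    have hi : IntegrableOn (fun x : ℝ => C * x ^ (2 * gam ν k - s)) (Set.Ioc 0 1) :=
      (((intervalIntegral.intervalIntegrable_rpow' (a := 0) (b := 1)
        (r := 2 * gam ν k - s) (by linarith)).1).const_mul C)
    refine Integrable.mono' hi ((hcont.mono Set.Ioc_subset_Ioi_self).aestronglyMeasurable
      measurableSet_Ioc) ?_
    refine (ae_restrict_iff' measurableSet_Ioc).2 (Eventually.of_forall fun x hx => ?_)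
    have hx0 : 0 < x := hx.1
    rw [Real.norm_of_nonneg (mul_nonneg (density_nonneg _ _) (by positivity)), sub_eq_add_neg,
      Real.rpow_add hx0, ← mul_assoc]
    exact mul_le_mul_of_nonneg_right (hC x hx.1 hx.2) (by positivity)
  have h2 : IntegrableOn (fun x => density (radialWave ν k) x * x ^ (-s)) (Set.Icc 1 (max 1 X)) :=
    (hcont.mono fun x hx => lt_of_lt_of_le one_pos hx.1).integrableOn_compact isCompact_Icc
  have h3 : IntegrableOn (fun x => density (radialWave ν k) x * x ^ (-s)) (Set.Ioi (max 1 X)) := by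
    have hm : 0 < max 1 X := lt_max_of_lt_left one_pos
    refine Integrable.mono' ((integrableOn_Ioi_rpow_of_lt (a := -s) (by linarith) hm).const_mul D)
      ((hcont.mono fun x hx => hm.trans hx).aestronglyMeasurable measurableSet_Ioi) ?_
    refine (ae_restrict_iff' measurableSet_Ioi).2 (Eventually.of_forall fun x hx => ?_)
    have hx0 : 0 < x := hm.trans hx
    rw [Real.norm_of_nonneg (mul_nonneg (density_nonneg _ _) (by positivity))]
    exact mul_le_mul_of_nonneg_right (hb x ((le_max_right _ _).trans (le_of_lt hx))) (by positivity)
  refine ((h1.union h2).union h3).mono_set fun x (hx : 0 < x) => ?_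
  rcases le_or_gt x 1 with hx1 | hx1
  · exact Or.inl (Or.inl ⟨hx, hx1⟩)
  rcases le_or_gt x (max 1 X) with hx2 | hx2
  · exact Or.inl (Or.inr ⟨hx1.le, hx2⟩)
  · exact Or.inr hx2

/-! ### Matrix entries, angular indices and the trace constant. -/

/-- The pair of radial waves at positive and negative energy. -/
noncomputable def wavePair (ν k : ℝ) : Fin 2 → ℝ → ℂ := ![radialWave ν k, radialWave (-ν) (-k)]

/-- The real bilinear form of two waves; `σ = 1` for the conjugate transpose and `σ = -1` for the
transpose. -/
noncomputable def pairForm (σ ν k : ℝ) (i j : Fin 2) (x : ℝ) : ℝ :=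
  (wavePair ν k i x).re * (wavePair ν k j x).re +
    σ * ((wavePair ν k i x).im * (wavePair ν k j x).im)

theorem abs_pairForm_le {σ : ℝ} (hσ : |σ| ≤ 1) (ν k : ℝ) (i j : Fin 2) (x : ℝ) :
    |pairForm σ ν k i j x| ≤ density (wavePair ν k i) x + density (wavePair ν k j) x := by
  unfold pairForm density
  generalize wavePair ν k i x = z
  generalize wavePair ν k j x = w
  have h1 : |z.re * w.re| ≤ (z.re ^ 2 + w.re ^ 2) / 2 := by
    rw [abs_le]; constructor <;> nlinarith [sq_nonneg (z.re + w.re), sq_nonneg (z.re - w.re)]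
  have h2 : |z.im * w.im| ≤ (z.im ^ 2 + w.im ^ 2) / 2 := by
    rw [abs_le]; constructor <;> nlinarith [sq_nonneg (z.im + w.im), sq_nonneg (z.im - w.im)]
  have h3 : |σ * (z.im * w.im)| ≤ |z.im * w.im| := by
    rw [abs_mul]; exact mul_le_of_le_one_left (abs_nonneg _) hσ
  have := abs_add_le (z.re * w.re) (σ * (z.im * w.im))
  nlinarith [sq_nonneg z.re, sq_nonneg w.re, sq_nonneg z.im, sq_nonneg w.im]

theorem abs_pairForm_self_le {σ : ℝ} (hσ : |σ| ≤ 1) (ν k : ℝ) (i : Fin 2) (x : ℝ) :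
    |pairForm σ ν k i i x| ≤ density (wavePair ν k i) x := by
  have h := abs_le.1 hσ
  unfold pairForm density
  generalize wavePair ν k i x = z
  rw [abs_le]
  constructor <;> nlinarith [mul_self_nonneg z.re, mul_self_nonneg z.im]

theorem gam_neg (ν k : ℝ) : gam (-ν) (-k) = gam ν k := by simp [gam]

theorem wavePair_solution {ν k : ℝ} (h : |ν| < |k|) (i : Fin 2) :
    ∃ ν' k' : ℝ, |ν'| = |ν| ∧ k' ^ 2 - ν' ^ 2 = k ^ 2 - ν ^ 2 ∧ |ν'| < |k'| ∧
      gam ν' k' = gam ν k ∧ wavePair ν k i = radialWave ν' k' := by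
  fin_cases i
  · exact ⟨ν, k, rfl, rfl, h, rfl, rfl⟩
  · exact ⟨-ν, -k, abs_neg ν, by ring, by simpa using h, gam_neg ν k, rfl⟩

theorem integrableOn_density_wavePair {ν k s : ℝ} (h : |ν| < |k|) (hs : 1 < s)
    (hs' : s < 2 * gam ν k + 1) (i : Fin 2) :
    IntegrableOn (fun x => density (wavePair ν k i) x * x ^ (-s)) (Set.Ioi 0) := by
  obtain ⟨ν', k', -, -, h', hg, e⟩ := wavePair_solution h i
  rw [e]
  exact integrableOn_density_radialWave h' hs (by rw [hg]; exact hs')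

theorem integrableOn_pairForm {σ ν k s : ℝ} (hσ : |σ| ≤ 1) (h : |ν| < |k|) (hs : 1 < s)
    (hs' : s < 2 * gam ν k + 1) (i j : Fin 2) :
    IntegrableOn (fun x => pairForm σ ν k i j x * x ^ (-s)) (Set.Ioi 0) := by
  have hc : ∀ i, ContinuousOn (wavePair ν k i) (Set.Ioi 0) := by
    intro i
    obtain ⟨ν', k', -, -, h', hg, e⟩ := wavePair_solution h i
    rw [e]
    exact (isRadialSolution_radialWave h').continuousOn
  have hre : ∀ i, ContinuousOn (fun x => (wavePair ν k i x).re) (Set.Ioi 0) := fun i =>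
    continuous_re.comp_continuousOn (hc i)
  have him : ∀ i, ContinuousOn (fun x => (wavePair ν k i x).im) (Set.Ioi 0) := fun i =>
    continuous_im.comp_continuousOn (hc i)
  have hrp : ContinuousOn (fun x : ℝ => x ^ (-s)) (Set.Ioi 0) := fun x (hx : 0 < x) =>
    (Real.continuousAt_rpow_const x (-s) (Or.inl hx.ne')).continuousWithinAt
  have hcont : ContinuousOn (fun x => pairForm σ ν k i j x * x ^ (-s)) (Set.Ioi 0) :=
    (((hre i).mul (hre j)).add (((him i).mul (him j)).const_mul σ)).mul hrp
  refine Integrable.mono' ((integrableOn_density_wavePair h hs hs' i).add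
    (integrableOn_density_wavePair h hs hs' j))
    (hcont.aestronglyMeasurable measurableSet_Ioi) ?_
  refine (ae_restrict_iff' measurableSet_Ioi).2 (Eventually.of_forall fun x (hx : 0 < x) => ?_)
  have hp : 0 < x ^ (-s) := Real.rpow_pos_of_pos hx _
  rw [Real.norm_eq_abs, abs_mul, abs_of_pos hp, Pi.add_apply, ← add_mul]
  exact mul_le_mul_of_nonneg_right (abs_pairForm_le hσ ν k i j x) hp.le

theorem radF_eq (n : ℕ) (ν k : ℝ) {x : ℝ} (hx : 0 < x) :
    radF n ν k x = (((2 * x) ^ (-(((n : ℝ) - 1) / 2)) * (radialWave ν k x).re : ℝ) : ℂ) := by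
  rw [radF, amplitude, radialWave, re_ofReal_mul, sub_eq_add_neg, Real.rpow_add (by positivity),
    normalization]
  congr 1; ring

theorem radG_eq (n : ℕ) (ν k : ℝ) {x : ℝ} (hx : 0 < x) :
    radG n ν k x = I * (((2 * x) ^ (-(((n : ℝ) - 1) / 2)) * (radialWave ν k x).im : ℝ) : ℂ) := by
  rw [radG, amplitude, radialWave, im_ofReal_mul, sub_eq_add_neg, Real.rpow_add (by positivity),
    normalization]
  congr 2; ring

/-- The upper components are real and the lower ones purely imaginary, so dropping the conjugation
only reverses the sign of the product of imaginary parts. A single `σ = ±1` covers both adjoints. -/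
theorem exists_matH_mul {adj : Matrix (Fin 2) (Fin 2) ℂ → Matrix (Fin 2) (Fin 2) ℂ}
    (hadj : adj = Matrix.conjTranspose ∨ adj = Matrix.transpose) (n : ℕ) (ν : ℝ) :
    ∃ σ : ℝ, |σ| ≤ 1 ∧ ∀ (k x : ℝ), 0 < x → ∀ i j : Fin 2,
      (matH n ν k x * adj (matH n ν k x)) i j =
        (((2 * x) ^ (-((n : ℝ) - 1)) * pairForm σ ν k i j x : ℝ) : ℂ) := by
  have hsq : ∀ x : ℝ, 0 < x → (2 * x) ^ (-((n : ℝ) - 1)) =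
      (2 * x) ^ (-(((n : ℝ) - 1) / 2)) * (2 * x) ^ (-(((n : ℝ) - 1) / 2)) := by
    intro x hx
    rw [← Real.rpow_add (by positivity)]; congr 1; ring
  rcases hadj with rfl | rfl
  · refine ⟨1, by simp, fun k x hx i j => ?_⟩
    rw [hsq x hx]
    generalize hp : (2 * x) ^ (-(((n : ℝ) - 1) / 2)) = p
    fin_cases i <;> fin_cases j <;>
    · simp [matH, Matrix.mul_apply, Fin.sum_univ_two, radF_eq n _ _ hx, radG_eq n _ _ hx, hp,
        pairForm, wavePair]
      ring_nf
      simp only [I_sq]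
      ring
  · refine ⟨-1, by simp, fun k x hx i j => ?_⟩
    rw [hsq x hx]
    generalize hp : (2 * x) ^ (-(((n : ℝ) - 1) / 2)) = p
    fin_cases i <;> fin_cases j <;>
    · simp [matH, Matrix.mul_apply, Fin.sum_univ_two, radF_eq n _ _ hx, radG_eq n _ _ hx, hp,
        pairForm, wavePair]
      ring_nf
      simp only [I_sq]
      ring

/-- The smallest `|k|` is `(n - 1) / 2` in both dimensions, which is the excluded endpoint for
`|ν|`. -/
theorem abs_lt_abs_of_mem_indexSet {n : ℕ} (hn : n = 2 ∨ n = 3) {ν k : ℝ}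
    (hν : ν ∈ Set.Ioo (-(((n : ℝ) - 1) / 2)) (((n : ℝ) - 1) / 2)) (hk : k ∈ indexSet n) :
    |ν| < |k| := by
  have h1 : |ν| < ((n : ℝ) - 1) / 2 := abs_lt.2 ⟨hν.1, hν.2⟩
  refine h1.trans_le ?_
  rcases hn with rfl | rfl
  · simp only [indexSet, if_true] at hk
    obtain ⟨m, rfl⟩ := hk
    rw [le_abs]
    rcases le_or_gt 0 m with hm | hm
    · left
      have : (0 : ℝ) ≤ m := by exact_mod_cast hm
      push_cast; linarith
    · right
      have : (m : ℝ) ≤ -1 := by exact_mod_cast Int.le_sub_one_of_lt hm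
      push_cast; linarith
  · simp only [indexSet] at hk
    obtain ⟨m, hm, rfl⟩ := hk
    have : (1 : ℝ) ≤ |(m : ℝ)| := by exact_mod_cast Int.one_le_abs hm
    push_cast; linarith

theorem finite_indexSet_inter (n : ℕ) (R : ℝ) : {k | k ∈ indexSet n ∧ |k| ≤ R}.Finite := by
  have hf : ∀ c : ℝ, {m : ℤ | |c + m| ≤ R}.Finite := by
    intro c
    refine (Set.finite_Icc ⌊-R - c⌋ ⌈R - c⌉).subset fun m hm => ?_
    have h := abs_le.1 (Set.mem_ofPred.1 hm)
    constructor
    · have : (⌊-R - c⌋ : ℝ) ≤ m := (Int.floor_le _).trans (by linarith [h.1])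
      exact_mod_cast this
    · have : (m : ℝ) ≤ ⌈R - c⌉ := le_trans (by linarith [h.2]) (Int.le_ceil _)
      exact_mod_cast this
  by_cases hn : n = 2
  · refine ((hf (1 / 2)).image fun m : ℤ => (1 / 2 : ℝ) + m).subset ?_
    rintro k ⟨hk, hR⟩
    rw [indexSet, if_pos hn] at hk
    obtain ⟨m, rfl⟩ := hk
    exact ⟨m, hR, rfl⟩
  · refine ((hf 0).image fun m : ℤ => (0 : ℝ) + m).subset ?_
    rintro k ⟨hk, hR⟩
    rw [indexSet, if_neg hn] at hk
    obtain ⟨m, -, rfl⟩ := hk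
    exact ⟨m, by simpa using hR, by simp⟩

/-- The proportionality constant of the trace of the kernel. -/
noncomputable def traceConst (σ : ℝ) (n : ℕ) (ν s k : ℝ) : ℝ :=
  2 ^ (-((n : ℝ) - 1)) *
    ∑ i : Fin 2, ∫ x in Set.Ioi (0 : ℝ), pairForm σ ν k i i x * x ^ (-s)

theorem abs_traceConst_le {σ : ℝ} (hσ : |σ| ≤ 1) {n : ℕ} (hn : 1 ≤ n) {ν s k : ℝ} (h : |ν| < |k|)
    (hs : 1 < s) (hs' : s < 2 * gam ν k + 1) :
    |traceConst σ n ν s k| ≤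
      ∑ i : Fin 2, ∫ x in Set.Ioi (0 : ℝ), density (wavePair ν k i) x * x ^ (-s) := by
  have hn' : (1 : ℝ) ≤ n := by exact_mod_cast hn
  have h2 : (2 : ℝ) ^ (-((n : ℝ) - 1)) ≤ 1 :=
    Real.rpow_le_one_of_one_le_of_nonpos one_le_two (by linarith)
  rw [traceConst, abs_mul, abs_of_pos (Real.rpow_pos_of_pos two_pos _)]
  refine (mul_le_of_le_one_left (abs_nonneg _) h2).trans ?_
  refine (Finset.abs_sum_le_sum_abs _ _).trans (Finset.sum_le_sum fun i _ => ?_)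
  rw [← Real.norm_eq_abs]
  refine (norm_integral_le_integral_norm _).trans ?_
  refine setIntegral_mono_on (integrableOn_pairForm hσ h hs hs' i i).norm
    (integrableOn_density_wavePair h hs hs' i) measurableSet_Ioi fun x (hx : 0 < x) => ?_
  have hp : 0 < x ^ (-s) := Real.rpow_pos_of_pos hx _
  rw [norm_mul, Real.norm_of_nonneg hp.le]
  exact mul_le_mul_of_nonneg_right (abs_pairForm_self_le hσ ν k i x) hp.le

end DiracCoulomb

/-! ### Scaling and the uniform bound. -/

theorem proposition3p1 (n : ℕ) (hn : n = 2 ∨ n = 3) (ν : ℝ)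
    (hν : ν ∈ Set.Ioo (-(((n : ℝ) - 1) / 2)) (((n : ℝ) - 1) / 2))
    (α : ℝ) (hα : 1 / 2 < α)
    (adj : Matrix (Fin 2) (Fin 2) ℂ → Matrix (Fin 2) (Fin 2) ℂ)
    (hadj : adj = Matrix.conjTranspose ∨ adj = Matrix.transpose) :
    ∃ C : ℝ → ℝ,
      (∀ k ∈ DiracCoulomb.indexSet n, α < √(k ^ 2 - ν ^ 2) + 1 / 2 →
        ∀ τ : ℝ, 0 < τ →
          (∀ i j : Fin 2, MeasureTheory.IntegrableOn
            (fun ε : ℝ => DiracCoulomb.kernelIntegrand adj n ν k (-2 * α) τ τ ε i j)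
            (Set.Ioi 0)) ∧
          (DiracCoulomb.kernelS adj n ν k (-2 * α) τ τ).trace =
            ((C k * τ ^ (2 * α - (n : ℝ)) : ℝ) : ℂ)) ∧
      BddAbove ((fun k => |C k|) ''
        {k | k ∈ DiracCoulomb.indexSet n ∧ α < √(k ^ 2 - ν ^ 2) + 1 / 2}) := by
  obtain ⟨σ, hσ, hmat⟩ := DiracCoulomb.exists_matH_mul hadj n ν
  have hs : 1 < 2 * α := by linarith
  have hlt : ∀ k ∈ DiracCoulomb.indexSet n, |ν| < |k| := fun k hk =>
    DiracCoulomb.abs_lt_abs_of_mem_indexSet hn hν hk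
  have hγ : ∀ k : ℝ, α < √(k ^ 2 - ν ^ 2) + 1 / 2 → 2 * α < 2 * DiracCoulomb.gam ν k + 1 := by
    intro k hk
    unfold DiracCoulomb.gam
    linarith
  refine ⟨DiracCoulomb.traceConst σ n ν (2 * α), fun k hk hkα τ hτ => ?_, ?_⟩
  · have hint := fun i j : Fin 2 =>
      DiracCoulomb.integrableOn_pairForm hσ (hlt k hk) hs (hγ k hkα) i j
    -- The exponent of `τ` is one more than the final `2α - n`; the change of variable `x = ε τ`
    -- supplies the missing `τ⁻¹`.
    set c : ℝ := 2 ^ (-((n : ℝ) - 1)) * τ ^ (2 * α - (n : ℝ) + 1) with hc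
    have hker : ∀ i j : Fin 2, ∀ ε ∈ Set.Ioi (0 : ℝ),
        DiracCoulomb.kernelIntegrand adj n ν k (-2 * α) τ τ ε i j =
          ((c * (DiracCoulomb.pairForm σ ν k i j (ε * τ) * (ε * τ) ^ (-(2 * α))) : ℝ) : ℂ) := by
      intro i j ε hε
      have hε' : (0 : ℝ) < ε := hε
      rw [DiracCoulomb.kernelIntegrand, Matrix.smul_apply, smul_eq_mul,
        hmat k (ε * τ) (by positivity) i j, ← Complex.ofReal_mul]
      congr 1
      rw [hc, Real.mul_rpow two_pos.le (by positivity), Real.mul_rpow hε'.le hτ.le,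
        Real.mul_rpow hε'.le hτ.le]
      have e1 : ε ^ ((n : ℝ) - 1 + -2 * α) * ε ^ (-((n : ℝ) - 1)) = ε ^ (-(2 * α)) := by
        rw [← Real.rpow_add hε']; congr 1; ring
      have e2 : τ ^ (2 * α - (n : ℝ) + 1) * τ ^ (-(2 * α)) = τ ^ (-((n : ℝ) - 1)) := by
        rw [← Real.rpow_add hτ]; congr 1; ring
      rw [← e1, ← e2]
      ring
    have hintτ : ∀ i j : Fin 2, MeasureTheory.IntegrableOn (fun ε : ℝ =>
        DiracCoulomb.pairForm σ ν k i j (ε * τ) * (ε * τ) ^ (-(2 * α))) (Set.Ioi 0) := by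
      intro i j
      refine (MeasureTheory.integrableOn_Ioi_comp_mul_right_iff
        (fun x => DiracCoulomb.pairForm σ ν k i j x * x ^ (-(2 * α))) 0 hτ).2 ?_
      rw [zero_mul]; exact hint i j
    refine ⟨fun i j => ?_, ?_⟩
    · refine MeasureTheory.IntegrableOn.congr_fun
        (((hintτ i j).const_mul c).ofReal (𝕜 := ℂ)) ?_ measurableSet_Ioi
      intro ε hε
      exact (hker i j ε hε).symm
    · have hval : ∀ i j : Fin 2, DiracCoulomb.kernelS adj n ν k (-2 * α) τ τ i j =
          ((c * (τ⁻¹ * ∫ x in Set.Ioi (0 : ℝ),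
            DiracCoulomb.pairForm σ ν k i j x * x ^ (-(2 * α))) : ℝ) : ℂ) := by
        intro i j
        rw [DiracCoulomb.kernelS, Matrix.of_apply,
          MeasureTheory.setIntegral_congr_fun measurableSet_Ioi (hker i j),
          integral_complex_ofReal, MeasureTheory.integral_const_mul,
          MeasureTheory.integral_comp_mul_right_Ioi
            (fun x => DiracCoulomb.pairForm σ ν k i j x * x ^ (-(2 * α))) 0 hτ, zero_mul,
          smul_eq_mul]
      rw [Matrix.trace, Fin.sum_univ_two, Matrix.diag_apply, Matrix.diag_apply, hval, hval,
        ← Complex.ofReal_add, DiracCoulomb.traceConst, Fin.sum_univ_two, hc,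
        Real.rpow_add hτ, Real.rpow_one]
      congr 1
      have := hτ.ne'
      field_simp
  · obtain ⟨B, g₀, hB, hmom⟩ := DiracCoulomb.exists_integral_density_le hs
    have hν1 : |ν| ≤ 1 := by
      rw [abs_le]
      rcases hn with rfl | rfl <;> push_cast at hν <;> constructor <;> linarith [hν.1, hν.2]
    -- As `|ν| ≤ 1`, `|k| > R` forces `k² - ν² ≥ (|g₀| + 1)²`, hence `γ ≥ |g₀| + 1`; both thresholds
    -- of the Morawetz bound are then met.
    set R : ℝ := |g₀| + 2 with hR
    have hfin := (DiracCoulomb.finite_indexSet_inter n R).image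
      fun k => |DiracCoulomb.traceConst σ n ν (2 * α) k|
    -- Finitely many indices have `|k| ≤ R`. For the others each of the two waves contributes at
    -- most `B` times the limiting density `2`.
    refine (hfin.bddAbove.union (bddAbove_Iic (a := B * 2 + B * 2))).mono ?_
    rintro _ ⟨k, ⟨hk, hkα⟩, rfl⟩
    rcases le_or_gt |k| R with hkR | hkR
    · exact Or.inl ⟨k, ⟨hk, hkR⟩, rfl⟩
    · right
      have hg : (|g₀| + 1) ^ 2 ≤ k ^ 2 - ν ^ 2 := by
        have h1 : R ^ 2 ≤ k ^ 2 := by rw [← sq_abs k]; gcongr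
        have h2 : ν ^ 2 ≤ 1 := by rw [← sq_abs]; nlinarith [abs_nonneg ν]
        nlinarith [abs_nonneg g₀]
      have hg1 : g₀ ≤ k ^ 2 - ν ^ 2 := by nlinarith [abs_nonneg g₀, le_abs_self g₀]
      have hg2 : g₀ ≤ 2 * DiracCoulomb.gam ν k := by
        have : |g₀| + 1 ≤ DiracCoulomb.gam ν k := Real.le_sqrt_of_sq_le hg
        linarith [abs_nonneg g₀, le_abs_self g₀]
      refine (DiracCoulomb.abs_traceConst_le hσ (by omega) (hlt k hk) hs (hγ k hkα)).trans ?_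
      have hi : ∀ i : Fin 2, ∫ x in Set.Ioi (0 : ℝ),
          DiracCoulomb.density (DiracCoulomb.wavePair ν k i) x * x ^ (-(2 * α)) ≤ B * 2 := by
        intro i
        obtain ⟨ν', k', hν', hsq, h', hgam, e⟩ := DiracCoulomb.wavePair_solution (hlt k hk) i
        obtain ⟨C, hC⟩ := DiracCoulomb.exists_density_radialWave_le h'
        rw [e]
        exact hmom ν' k' C 2 _ _ (hν' ▸ hν1) (hsq ▸ hg1) (by rw [hgam]; exact hg2)
          (DiracCoulomb.isRadialSolution_radialWave h') hC
          (DiracCoulomb.tendsto_density_radialWave h')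
      rw [Fin.sum_univ_two]
      exact add_le_add (hi 0) (hi 1)
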